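/- **Theorem 2.2 (law of large numbers).** Fix integers $1\le k\le L$ and $c\ge 1$, a rate $\lambda>0$ and a horizon $T\in[0,\infty)$. For each $n\ge L$ consider the following system of $n$ servers, each with its own infinite-capacity queue. Files are stored on the servers so that each file is stored at exactly $L$ servers and each set of $L$ servers holds exactly $c$ files. Requests arrive according to a Poisson process with rate $n\lambda$, and each requests one of the files uniformly at random; one job is then sent to each of the $k$ shortest queues among the $L$ servers that hold this file (ties are broken by an arbitrary, possibly randomized, rule that depends on the current queue lengths and on this set of servers). Each server processes its queue in first-in-first-out order; processing times are independent and exponential with mean $1/k$. Let $Q^n(t)=(Q^n_1(t),\dots,Q^n_n(t))$ be the queue lengths at time $t\in[0,T]$, started from a nonrandom $Q^n(0)=q^n\in\mathbb{N}_0^n$; equivalently, $Q^n$ is the continuous-time Markov chain on $\mathbb{N}_0^n$ in which $q$ jumps to $q+\sum_{i\in B}e_i$ when a request is sent to the set $B$ of servers and to $q-e_i$ at rate $k$ for each $i$ with $q_i>0$. Let $$\pi^n_i(t)=\frac1n\sum_{j=1}^n 1_{\{Q^n_j(t)=i\}},\qquad i\in\mathbb{N}_0,$$ be the empirical measure of the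 queue lengths. It takes values in $\mathcal{S}=\{s\in\mathbb{R}_+^{\mathbb{N}_0}:\sum_{i}s_i=1\}=\mathcal{P}(\mathbb{N}_0)$, which carries the metric $d_0(s,s')=\sum_{j\ge0}2^{-j}|s_j-s'_j|$ (that is, the topology of weak convergence). For $r\in\boldsymbol\ell_1$ and $j\in\mathbb{N}_0$ let (with $0^0=1$ and empty sums equal to $0$) $$\bar\zeta(j,r)=\sum_{i_1=0}^{k-1}\frac{\big(\sum_{m=0}^{j-1}r_m\big)^{i_1}}{i_1!}\sum_{i_2=1}^{L-i_1}\min(i_2,k-i_1)\,\frac{r_j^{i_2}}{i_2!}\,\frac{\big(\sum_{m=j+1}^\infty r_m\big)^{L-i_1-i_2}}{(L-i_1-i_2)!},\qquad \bar\zeta(-1,r)=0,$$ and let $F:\boldsymbol\ell_1\to\boldsymbol\ell_1$ be the map with coordinates $$F_j(r)=\lambda L!\,\big[\bar\zeta(j-1,r)-\bar\zeta(j,r)\big]+k\,[r_{j+1}-r_j]+k\,r_0\,1_{\{j=0\}},\qquad j\in\mathbb{N}_0 .$$ Suppose that $\pi^n(0)\to\pi_0$ in $\mathcal{S}$ as $n\to\infty$.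 Then there is exactly one continuous $\pi:[0,T]\to\mathcal{S}$ that solves $\dot\pi=F(\pi)$, $\pi(0)=\pi_0$, in the sense that $\pi(t)=\pi_0+\int_0^tF(\pi(s))\,ds$ for all $t\in[0,T]$ (a Bochner integral in $\boldsymbol\ell_1$); and $\pi^n\to\pi$ in probability in $\mathbb{D}([0,T]:\mathcal{S})$, the space of right-continuous functions with left limits from $[0,T]$ to $\mathcal{S}$ with the Skorohod ($J_1$) topology. -/

import Mathlib

open MeasureTheory ProbabilityTheory Filter Topology
open scoped ENNReal

noncomputable section

namespace BatchMDS

/-! ### The simplex `𝒮 = 𝒫(ℕ₀)` with the metric `d₀` -/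

/-- The infinite-dimensional simplex, identified with the probability measures on `{0, 1, 2, …}`. -/
def Simplex : Type := {s : ℕ → ℝ // (∀ i, 0 ≤ s i) ∧ HasSum s 1}

namespace Simplex

instance : CoeFun Simplex (fun _ => ℕ → ℝ) := ⟨Subtype.val⟩

theorem nonneg (s : Simplex) (i : ℕ) : 0 ≤ s i := s.2.1 i

theorem hasSum (s : Simplex) : HasSum s 1 := s.2.2

theorem summable_dist (s t : Simplex) : Summable fun j => |s j - t j| / 2 ^ j := by
  refine Summable.of_nonneg_of_le (fun j => by positivity) (fun j => ?_)
    (s.hasSum.summable.add t.hasSum.summable)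
  have h1 : |s j - t j| / 2 ^ j ≤ |s j - t j| :=
    div_le_self (abs_nonneg _) (one_le_pow₀ (by norm_num))
  refine h1.trans (abs_le.2 ⟨?_, ?_⟩) <;> linarith [s.nonneg j, t.nonneg j]

/-- The metric `d₀(s, t) = ∑ⱼ |sⱼ - tⱼ| / 2ʲ`, which metrizes weak convergence. -/
instance : MetricSpace Simplex where
  dist s t := ∑' j, |s j - t j| / 2 ^ j
  dist_self s := by simp
  dist_comm s t := by simp_rw [abs_sub_comm]
  dist_triangle s t u := by
    rw [← (summable_dist s t).tsum_add (summable_dist t u)]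
    refine (summable_dist s u).tsum_le_tsum (fun j => ?_)
      ((summable_dist s t).add (summable_dist t u))
    rw [← add_div]
    gcongr
    exact abs_sub_le _ _ _
  eq_of_dist_eq_zero := by
    intro s t h
    have h0 := (hasSum_zero_iff_of_nonneg (fun j => by positivity)).1
      (h ▸ (summable_dist s t).hasSum)
    refine Subtype.ext (funext fun j => ?_)
    have hj := congrFun h0 j
    have h2 : (2 : ℝ) ^ j ≠ 0 := by positivity
    simp only [Pi.zero_apply, div_eq_zero_iff, h2, or_false, abs_eq_zero] at hj
    linarith

theorem memℓp (s : Simplex) : Memℓp (fun j => s j) 1 := by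
  refine memℓp_gen ?_
  simpa [abs_of_nonneg (s.nonneg _)] using s.hasSum.summable

end Simplex

/-- The Banach space `ℓ₁` of absolutely summable real sequences. -/
abbrev L1 : Type := lp (fun _ : ℕ => ℝ) 1

/-- The inclusion of the simplex into `ℓ₁`. -/
def Simplex.toL1 (s : Simplex) : L1 := ⟨fun j => s j, s.memℓp⟩

/-! ### The drift `F` -/

/-- The quantity `ζ̄(j, r)`. -/
def zetaBar (L k : ℕ) (j : ℕ) (r : ℕ → ℝ) : ℝ :=
  ∑ i₁ ∈ Finset.range k,
    (∑ m ∈ Finset.range j, r m) ^ i₁ / (i₁.factorial : ℝ) *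
      ∑ i₂ ∈ Finset.Icc 1 (L - i₁),
        (min i₂ (k - i₁) : ℕ) * (r j ^ i₂ / (i₂.factorial : ℝ)) *
          ((∑' m, r (j + 1 + m)) ^ (L - i₁ - i₂) / ((L - i₁ - i₂).factorial : ℝ))

/-- `ζ̄(j - 1, r) - ζ̄(j, r)`, where `ζ̄(-1, r) = 0`. -/
def zetaBarDelta (L k : ℕ) (j : ℕ) (r : ℕ → ℝ) : ℝ :=
  (if j = 0 then 0 else zetaBar L k (j - 1) r) - zetaBar L k j r

/-- The `j`-th coordinate of `F(r)`; the last term removes the service rate of the empty queues. -/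
def driftCoord (L k : ℕ) (lam : ℝ) (r : ℕ → ℝ) (j : ℕ) : ℝ :=
  lam * (L.factorial : ℝ) * zetaBarDelta L k j r + k * (r (j + 1) - r j)
    + if j = 0 then k * r 0 else 0

theorem summable_abs_zetaBar (L k : ℕ) (r : ℕ → ℝ) (hr : Summable fun j => |r j|) :
    Summable fun j => |zetaBar L k j r| := by
  have hR : ∀ j, |r j| ≤ ∑' m, |r m| := fun j => hr.le_tsum j (fun _ _ => abs_nonneg _)
  set R := ∑' m, |r m| with hRdef
  have hA : ∀ j, |∑ m ∈ Finset.range j, r m| ≤ R := fun j =>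
    (Finset.abs_sum_le_sum_abs _ _).trans (hr.sum_le_tsum _ (fun _ _ => abs_nonneg _))
  have hB : ∀ j, |∑' m, r (j + 1 + m)| ≤ R := fun j => by
    have hinj : Function.Injective fun m : ℕ => j + 1 + m := fun a b h => by simpa using h
    have hs : Summable fun m => |r (j + 1 + m)| := hr.comp_injective hinj
    refine (norm_tsum_le_tsum_norm (f := fun m => r (j + 1 + m)) hs).trans ?_
    exact Summable.tsum_le_tsum_of_inj _ hinj (fun _ _ => abs_nonneg _) (fun _ => le_rfl) hs hr
  have key : ∀ j, |zetaBar L k j r| ≤ (∑ i₁ ∈ Finset.range k,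
      R ^ i₁ / (i₁.factorial : ℝ) * ∑ i₂ ∈ Finset.Icc 1 (L - i₁),
        (min i₂ (k - i₁) : ℕ) * (R ^ (i₂ - 1) / (i₂.factorial : ℝ)) *
          (R ^ (L - i₁ - i₂) / ((L - i₁ - i₂).factorial : ℝ))) * |r j| := by
    intro j
    have hR0 : 0 ≤ R := (abs_nonneg _).trans (hR 0)
    rw [Finset.sum_mul]
    refine (Finset.abs_sum_le_sum_abs _ _).trans (Finset.sum_le_sum fun i₁ _ => ?_)
    rw [abs_mul, mul_assoc, Finset.sum_mul]
    refine mul_le_mul ?_ ?_ (abs_nonneg _) (by positivity)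
    · rw [abs_div, abs_pow, Nat.abs_cast]
      gcongr
      exact hA j
    · refine (Finset.abs_sum_le_sum_abs _ _).trans (Finset.sum_le_sum fun i₂ hi₂ => ?_)
      obtain ⟨m, rfl⟩ : ∃ m, i₂ = m + 1 := ⟨i₂ - 1, by have := (Finset.mem_Icc.1 hi₂).1; omega⟩
      rw [abs_mul, abs_mul, abs_div, abs_div, abs_pow, abs_pow, Nat.abs_cast, Nat.abs_cast,
        Nat.abs_cast, Nat.add_sub_cancel]
      have h1 : |r j| ^ (m + 1) ≤ R ^ m * |r j| := by
        rw [pow_succ]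
        gcongr
        exact hR j
      have h2 : |∑' m, r (j + 1 + m)| ^ (L - i₁ - (m + 1)) ≤ R ^ (L - i₁ - (m + 1)) := by
        gcongr
        exact hB j
      calc _ ≤ ((min (m + 1) (k - i₁) : ℕ) : ℝ) * (R ^ m * |r j| / ((m + 1).factorial : ℝ)) *
            (R ^ (L - i₁ - (m + 1)) / ((L - i₁ - (m + 1)).factorial : ℝ)) := by gcongr
        _ = _ := by ring
  exact Summable.of_nonneg_of_le (fun _ => abs_nonneg _) key (hr.mul_left _)

theorem memℓp_driftCoord (L k : ℕ) (lam : ℝ) (r : L1) :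
    Memℓp (driftCoord L k lam (fun j => r j)) 1 := by
  have hr : Summable fun j => |r j| := by
    simpa using (lp.memℓp r).summable (by norm_num)
  have hz := summable_abs_zetaBar L k (fun j => r j) hr
  have hz' : Summable fun j : ℕ => if j = 0 then 0 else zetaBar L k (j - 1) (fun j => r j) := by
    rw [← summable_nat_add_iff 1]
    simpa using hz.of_abs
  have h0 : Summable fun j : ℕ => if j = 0 then (k : ℝ) * r 0 else 0 :=
    summable_of_ne_finset_zero (s := {0}) (by simp +contextual)
  have hs : Summable (driftCoord L k lam (fun j => r j)) :=
    (((hz'.sub hz.of_abs).mul_left _).add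
      ((((summable_nat_add_iff 1).2 hr.of_abs).sub hr.of_abs).mul_left _)).add h0
  refine memℓp_gen ?_
  simpa using hs.abs

/-- The map `F : ℓ₁ → ℓ₁`. -/
def drift (L k : ℕ) (lam : ℝ) (r : L1) : L1 :=
  ⟨driftCoord L k lam (fun j => r j), memℓp_driftCoord L k lam r⟩

/-- A continuous path `π : [0,T] → 𝒮` solves `π̇ = F(π)`, `π(0) = π₀` if
`π(t) = π₀ + ∫₀ᵗ F(π(s)) ds` for all `t ∈ [0,T]`, as a Bochner integral in `ℓ₁`. -/
def IsSolution (L k : ℕ) (lam : ℝ) {T : ℝ} (hT : 0 ≤ T) (π₀ : Simplex)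
    (π : C(Set.Icc (0 : ℝ) T, Simplex)) : Prop :=
  ∀ t : Set.Icc (0 : ℝ) T,
    IntervalIntegrable (Set.IccExtend hT fun s => drift L k lam (π s).toL1) volume 0 t ∧
    (π t).toL1 = π₀.toL1 +
      ∫ s in (0 : ℝ)..t, Set.IccExtend hT (fun s => drift L k lam (π s).toL1) s

/-! ### The Skorohod space `𝔻([0,T] : E)` -/

/-- Right continuous functions on `[0,T]` with left limits. -/
structure Cadlag (T : ℝ) (E : Type*) [TopologicalSpace E] where
  toFun : Set.Icc (0 : ℝ) T → E
  rightCts : ∀ t, ContinuousWithinAt toFun (Set.Ici t) t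
  leftLim : ∀ t, ∃ l, Tendsto toFun (𝓝[<] t) (𝓝 l)

instance (T : ℝ) (E : Type*) [TopologicalSpace E] :
    CoeFun (Cadlag T E) (fun _ => Set.Icc (0 : ℝ) T → E) := ⟨Cadlag.toFun⟩

/-- The image of a path under a continuous map of the state space. -/
def Cadlag.map {T : ℝ} {E E' : Type*} [TopologicalSpace E] [TopologicalSpace E']
    (g : E → E') (hg : Continuous g) (x : Cadlag T E) : Cadlag T E' where
  toFun t := g (x t)
  rightCts t := hg.continuousAt.comp_continuousWithinAt (x.rightCts t)
  leftLim t := (x.leftLim t).elim fun l hl => ⟨g l, (hg.tendsto l).comp hl⟩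

/-- A continuous path as an element of the Skorohod space. -/
def Cadlag.ofContinuous {T : ℝ} {E : Type*} [TopologicalSpace E]
    (x : C(Set.Icc (0 : ℝ) T, E)) : Cadlag T E where
  toFun := x
  rightCts _ := x.continuous.continuousWithinAt
  leftLim t := ⟨x t, (x.continuous.tendsto t).mono_left nhdsWithin_le_nhds⟩

/-- The metric of the Skorohod `J₁` topology: the infimum, over the increasing bijections `τ`
of `[0,T]`, of `max (sup_t |τ(t) - t|) (sup_t d(x(τ(t)), y(t)))`. -/
def skorohodEDist {T : ℝ} {E : Type*} [MetricSpace E] (x y : Cadlag T E) : ℝ≥0∞ :=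
  ⨅ τ : Set.Icc (0 : ℝ) T ≃o Set.Icc (0 : ℝ) T,
    max (⨆ t, edist (τ t) t) (⨆ t, edist (x (τ t)) (y t))

/-! ### The `n`-server system -/

/-- Storage of files on `n` servers with `(L, k)` MDS coding: each file is stored at `L` servers,
and each set of `L` servers holds exactly `c` files. -/
structure Storage (n L c : ℕ) where
  numFiles : ℕ
  servers : Fin numFiles → Finset (Fin n)
  card_servers : ∀ i, (servers i).card = L
  card_files : ∀ A : Finset (Fin n), A.card = L →
    (Finset.univ.filter fun i => servers i = A).card = c

/-- `B` consists of `k` servers of `A` with the shortest queues. -/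
def IsShortest {n : ℕ} (k : ℕ) (q : Fin n → ℕ) (A B : Finset (Fin n)) : Prop :=
  B ⊆ A ∧ B.card = k ∧ ∀ i ∈ B, ∀ j ∈ A \ B, q i ≤ q j

/-- A (possibly randomized) choice of the `k` shortest queues in a set of `L` servers:
`prob q A B` is the probability that a request for the set `A` is sent to the servers of `B`, if
the queue lengths are `q`. The freedom is in the way in which ties are broken. -/
structure Routing (n L k : ℕ) where
  prob : (Fin n → ℕ) → Finset (Fin n) → Finset (Fin n) → ℝ
  nonneg : ∀ q A B, 0 ≤ prob q A B
  shortest : ∀ q A B, A.card = L → prob q A B ≠ 0 → IsShortest k q A B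
  sum_eq_one : ∀ q A, A.card = L → ∑ B, prob q A B = 1

/-- One job joins each queue in `B`. -/
def arrive {n : ℕ} (q : Fin n → ℕ) (B : Finset (Fin n)) : Fin n → ℕ :=
  fun j => if j ∈ B then q j + 1 else q j

/-- One job leaves queue `i`. -/
def depart {n : ℕ} (q : Fin n → ℕ) (i : Fin n) : Fin n → ℕ := Function.update q i (q i - 1)

/-- The generator of the queue lengths: requests arrive at rate `n λ`, each for a uniformly chosen
file, and are sent to the `k` shortest queues among the servers of that file; each server with a
non-empty queue completes jobs at rate `k`. -/
def generator {n L c : ℕ} (k : ℕ) (lam : ℝ) (S : Storage n L c) (R : Routing n L k)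
    (f : (Fin n → ℕ) → ℝ) (q : Fin n → ℕ) : ℝ :=
  n * lam * (1 / (S.numFiles : ℝ) * ∑ i, ∑ B,
      R.prob q (S.servers i) B * (f (arrive q B) - f q)) +
    ∑ j, if 0 < q j then (k : ℝ) * (f (depart q j) - f q) else 0

/-- `Q` is the queue length process on `[0,T]` of the `n`-server system started from `q`: the
continuous time Markov chain, with respect to `ℱ`, with this (bounded) generator, given through its
martingale problem. -/
structure IsQueueProcess {n L c : ℕ} (k : ℕ) (lam : ℝ) {T : ℝ} (hT : 0 ≤ T)
    (S : Storage n L c) (R : Routing n L k) {Ω : Type*} [mΩ : MeasurableSpace Ω] (P : Measure Ω)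
    (ℱ : Filtration (Set.Icc (0 : ℝ) T) mΩ) (q : Fin n → ℕ)
    (Q : Ω → Cadlag T (Fin n → ℕ)) : Prop where
  adapted : ∀ t, Measurable[ℱ t] fun ω => Q ω t
  initial : ∀ᵐ ω ∂P, Q ω ⟨0, Set.left_mem_Icc.2 hT⟩ = q
  martingale : ∀ f : (Fin n → ℕ) → ℝ, (∃ C, ∀ x, |f x| ≤ C) →
    Martingale (fun (t : Set.Icc (0 : ℝ) T) ω => f (Q ω t) -
      ∫ s in (0 : ℝ)..t, Set.IccExtend hT (fun s => generator k lam S R f (Q ω s)) s) ℱ P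

/-- The empirical measure of the queue lengths: coordinate `i` is the proportion of the `n` queues
with length `i`. (If there are no queues it is set to the point mass at `0`.) -/
def empirical {n : ℕ} (q : Fin n → ℕ) : Simplex :=
  ⟨fun i => if n = 0 then (if i = 0 then 1 else 0) else
      (1 / (n : ℝ)) * ∑ j, if q j = i then 1 else 0, by
    rcases Nat.eq_zero_or_pos n with hn | hn
    · simp only [hn, if_true]
      exact ⟨fun i => by split_ifs <;> norm_num, hasSum_ite_eq 0 1⟩
    · simp only [hn.ne', if_false]
      refine ⟨fun i => mul_nonneg (by positivity)
        (Finset.sum_nonneg fun j _ => by split_ifs <;> norm_num), ?_⟩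
      have h : HasSum (fun i => ∑ j : Fin n, if q j = i then (1 : ℝ) else 0)
          (∑ _j : Fin n, (1 : ℝ)) := hasSum_sum fun j _ => by
        simpa [eq_comm] using hasSum_ite_eq (q j) (1 : ℝ)
      have h' := h.mul_left (1 / (n : ℝ))
      have hn' : (n : ℝ) ≠ 0 := by positivity
      simpa [hn'] using h'⟩

/-- The empirical measure process, as a path in `𝔻([0,T] : 𝒮)`. -/
def empiricalPath {n : ℕ} {T : ℝ} (x : Cadlag T (Fin n → ℕ)) : Cadlag T Simplex :=
  x.map empirical continuous_of_discreteTopology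

end BatchMDS

end

open BatchMDS

open MeasureTheory ProbabilityTheory Filter Topology
open scoped ENNReal

noncomputable section

namespace BatchMDS

/-! The empirical measure of the queues solves the limit equation up to a small random error, and
that equation is stable in `d₀` under perturbations.

Drift. Every set of `L` servers holds the same number of files, so a request picks a uniform
`L`-set. However ties are broken, the number of jobs sent to queues of length `j` depends only on
how many servers of this set have shorter queues and how many have length `j`
(`IsShortest.card_filter_eq`). The generator applied to a coordinate of the empirical measure is
therefore a hypergeometric mean; passing to sampling with replacement costs `O(1/n)` and produces
`F` (`abs_generator_empirical_sub_le`).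

Noise. A jump moves a coordinate by at most `k/n`, and jumps occur at rate `O(n)`, so the martingale
part of a coordinate has second moment `O(1/n)` (`integral_sq_martingale_increment_le`,
`generator_sq_sub_empirical_le`). Doob's inequality makes it small uniformly in time. The weights
`2⁻ʲ` in `d₀` tolerate thresholds that grow with `j`, so a union bound controls all coordinates at
once (`IsQueueProcess.measure_not_isApproxSolution_le`).

Stability. On the simplex the tail mass is one minus a partial sum, so `F_j` is a polynomial in `r₀,
…, r_{j+1}`. This makes `F` Lipschitz for `d₀` (`Simplex.sum_abs_driftCoord_sub_le`), and Gronwall's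
inequality bounds the distance of two approximate solutions by their errors
(`IsApproxSolution.dist_le`). Uniqueness follows, and so does convergence once a solution exists.

Existence comes from the queues themselves. Good sample paths have positive probability for large
`n`, so there are approximate solutions with errors tending to zero; by stability they converge
coordinatewise, and the limit solves the equation (`exists_solution_of_approx`). The simplex is not
complete for `d₀`, so it has to be checked that no mass escapes to infinity: the flux past level `J`
is at most a constant times the mass at `J`, which vanishes as `J → ∞`. -/

/-! ### A maximal inequality for right-continuous martingales on `[0,T]` -/

/-- The `i`-th point of the dyadic grid of level `m` in `[0,T]`. -/
def dyadicPoint {T : ℝ} (hT : 0 ≤ T) (m i : ℕ) : Set.Icc (0 : ℝ) T :=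
  Set.projIcc 0 T hT (i * (T / 2 ^ m))

theorem dyadicPoint_mono {T : ℝ} (hT : 0 ≤ T) (m : ℕ) : Monotone (dyadicPoint hT m) := by
  intro i j hij
  refine Set.monotone_projIcc hT ?_
  gcongr

theorem dyadicPoint_two_pow {T : ℝ} (hT : 0 ≤ T) (m : ℕ) :
    dyadicPoint hT m (2 ^ m) = ⟨T, Set.right_mem_Icc.2 hT⟩ := by
  refine Set.projIcc_of_right_le hT ?_
  push_cast
  rw [mul_div_cancel₀]
  positivity

theorem dyadicPoint_succ {T : ℝ} (hT : 0 ≤ T) (m i : ℕ) :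
    dyadicPoint hT (m + 1) (2 * i) = dyadicPoint hT m i := by
  unfold dyadicPoint
  congr 1
  push_cast
  rw [pow_succ]
  field_simp

/-- Rounding `t` up to the grid of mesh `T / 2 ^ m` moves it to the right by less than the mesh and
never beyond `T`, which lies on every grid. The right endpoint thus needs no special care; only `T =
0`, where the mesh vanishes, is separate. -/
theorem exists_dyadicPoint {T : ℝ} (hT : 0 ≤ T) (t : Set.Icc (0 : ℝ) T)
    {U : Set (Set.Icc (0 : ℝ) T)} (hU : U ∈ 𝓝[≥] t) : ∃ m i : ℕ, i ≤ 2 ^ m ∧ dyadicPoint hT m i ∈ U := by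
  rcases hT.eq_or_lt with h0 | hpos
  · refine ⟨0, 0, by simp, ?_⟩
    have : dyadicPoint hT 0 0 = t := by
      have : Subsingleton (Set.Icc (0 : ℝ) T) := by subst h0; simp
      exact Subsingleton.elim _ _
    rw [this]
    exact mem_of_mem_nhdsWithin (by simp) hU
  · obtain ⟨η, hη, hηU⟩ := Metric.mem_nhdsWithin_iff.1 hU
    obtain ⟨m, hm⟩ := exists_nat_gt (T / η)
    have hm2 : T / 2 ^ m < η := by
      rw [div_lt_iff₀ (by positivity)]
      rw [div_lt_iff₀ hη] at hm
      have : (m : ℝ) < 2 ^ m := by exact_mod_cast Nat.lt_two_pow_self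
      nlinarith
    set i := ⌈t.1 / (T / 2 ^ m)⌉₊ with hi
    have hd : 0 < T / 2 ^ m := by positivity
    have h1 : t.1 ≤ i * (T / 2 ^ m) := by
      rw [← div_le_iff₀ hd]; exact Nat.le_ceil _
    have h2 : i * (T / 2 ^ m) < t.1 + T / 2 ^ m := by
      have := Nat.ceil_lt_add_one (a := t.1 / (T / 2 ^ m)) (div_nonneg t.2.1 hd.le)
      rw [← hi, ← sub_lt_iff_lt_add, lt_div_iff₀ hd] at this
      linarith
    have hi2 : i ≤ 2 ^ m := by
      rw [hi, Nat.ceil_le, div_le_iff₀ hd]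
      push_cast
      rw [mul_div_cancel₀ _ (by positivity)]
      exact t.2.2
    refine ⟨m, i, hi2, hηU ?_⟩
    have hmem : (i : ℝ) * (T / 2 ^ m) ∈ Set.Icc 0 T := by
      refine ⟨by positivity, ?_⟩
      have : (i : ℝ) ≤ 2 ^ m := by exact_mod_cast hi2
      calc (i : ℝ) * (T / 2 ^ m) ≤ 2 ^ m * (T / 2 ^ m) := by gcongr
        _ = T := by rw [mul_div_cancel₀ _ (by positivity)]
    have he : dyadicPoint hT m i = ⟨_, hmem⟩ := Set.projIcc_of_mem hT hmem
    rw [he]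
    refine ⟨?_, h1⟩
    rw [Metric.mem_ball, Subtype.dist_eq, Real.dist_eq, abs_lt]
    constructor <;> dsimp only <;> linarith

theorem submartingale_abs {ι Ω : Type*} [Preorder ι] {mΩ : MeasurableSpace Ω} {P : Measure Ω}
    {ℱ : Filtration ι mΩ} {M : ι → Ω → ℝ} (hM : Martingale M ℱ P) :
    Submartingale (fun t ω => |M t ω|) ℱ P :=
  hM.submartingale.sup hM.neg.submartingale

/-- Doob's inequality holds on each dyadic grid with a bound that does not depend on the level. By
right continuity a strict exceedance persists on a right neighbourhood, hence is seen by some grid;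
the grid events increase with the level, so the bound passes to their union. -/
theorem measure_exists_lt_abs_le {Ω : Type*} {mΩ : MeasurableSpace Ω} {P : Measure Ω}
    [IsProbabilityMeasure P] {T : ℝ} (hT : 0 ≤ T) {ℱ : Filtration (Set.Icc (0 : ℝ) T) mΩ}
    {M : Set.Icc (0 : ℝ) T → Ω → ℝ} (hM : Martingale M ℱ P)
    (hrc : ∀ ω t, ContinuousWithinAt (fun t => M t ω) (Set.Ici t) t) {δ : ℝ} (hδ : 0 < δ) :
    P {ω | ∃ t, δ < |M t ω|} ≤
      ENNReal.ofReal ((∫ ω, |M ⟨T, Set.right_mem_Icc.2 hT⟩ ω| ∂P) / δ) := by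
  set E : ℕ → Set Ω := fun m => {ω | ∃ i ≤ 2 ^ m, δ ≤ |M (dyadicPoint hT m i) ω|} with hE
  have hmono : Monotone E := by
    refine monotone_nat_of_le_succ fun m ω => ?_
    rintro ⟨i, hi, h⟩
    exact ⟨2 * i, by rw [pow_succ]; omega, by rwa [dyadicPoint_succ]⟩
  have hsub : {ω | ∃ t, δ < |M t ω|} ⊆ ⋃ m, E m := by
    rintro ω ⟨t, ht⟩
    have hU : {s | δ < |M s ω|} ∈ 𝓝[≥] t := (hrc ω t).abs.eventually_const_lt ht
    obtain ⟨m, i, hi, hmem⟩ := exists_dyadicPoint hT t hU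
    exact Set.mem_iUnion.2 ⟨m, i, hi, le_of_lt hmem⟩
  have hbound : ∀ m, P (E m) ≤
      ENNReal.ofReal ((∫ ω, |M ⟨T, Set.right_mem_Icc.2 hT⟩ ω| ∂P) / δ) := by
    intro m
    -- Indices beyond `2 ^ m` are clamped to `T`, so the sampled family is a filtration indexed by
    -- all of `ℕ`.
    let 𝒢 : Filtration ℕ mΩ :=
      ⟨fun i => ℱ (dyadicPoint hT m i), fun i j hij => ℱ.mono (dyadicPoint_mono hT m hij),
        fun i => ℱ.le _⟩
    have hS : Submartingale (fun i ω => |M (dyadicPoint hT m i) ω|) 𝒢 P := by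
      have h := submartingale_abs hM
      exact ⟨fun i => h.1 _, fun i j hij => h.2.1 _ _ (dyadicPoint_mono hT m hij),
        fun i => h.2.2 _⟩
    lift δ to NNReal using hδ.le
    have hEq : E m = {ω | (δ : ℝ) ≤ (Finset.range (2 ^ m + 1)).sup'
        Finset.nonempty_range_add_one fun k => |M (dyadicPoint hT m k) ω|} := by
      ext ω
      simp [hE, Finset.le_sup'_iff]
    have h : δ * P (E m) ≤ ENNReal.ofReal (∫ ω in E m, |M (dyadicPoint hT m (2 ^ m)) ω| ∂P) := by
      rw [hEq]
      exact maximal_ineq hS (fun i ω => abs_nonneg _) (2 ^ m)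
    rw [dyadicPoint_two_pow] at h
    rw [ENNReal.ofReal_div_of_pos hδ, ENNReal.le_div_iff_mul_le (Or.inl (ENNReal.ofReal_pos.2 hδ).ne')
      (by simp), mul_comm, ENNReal.ofReal_coe_nnreal]
    refine h.trans (ENNReal.ofReal_le_ofReal ?_)
    exact setIntegral_le_integral (hM.integrable _).abs (ae_of_all _ fun ω => abs_nonneg _)
  calc P {ω | ∃ t, δ < |M t ω|} ≤ P (⋃ m, E m) := measure_mono hsub
    _ = ⨆ m, P (E m) := hmono.measure_iUnion
    _ ≤ _ := iSup_le hbound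

/-! ### Joint measurability of right-continuous processes -/

/-- Rounding the time strictly up to a multiple of `2⁻ᵐ` leaves countably many values, hence a
jointly measurable process; right continuity gives convergence as `m → ∞`. -/
theorem measurable_uncurry_of_rightCts {Ω E : Type*} {mΩ : MeasurableSpace Ω} {T : ℝ} (hT : 0 ≤ T)
    [TopologicalSpace E] [TopologicalSpace.PseudoMetrizableSpace E] [MeasurableSpace E]
    [BorelSpace E] {X : Set.Icc (0 : ℝ) T → Ω → E} (hX : ∀ t, Measurable (X t))
    (hrc : ∀ ω t, ContinuousWithinAt (fun t => X t ω) (Set.Ici t) t) :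
    Measurable fun p : ℝ × Ω => X (Set.projIcc 0 T hT p.1) p.2 := by
  let ρ : ℕ → ℝ → ℝ := fun m s => (⌊s * 2 ^ m⌋ + 1 : ℝ) / 2 ^ m
  have hρ : ∀ m s, s < ρ m s ∧ ρ m s ≤ s + (1 / 2) ^ m := by
    intro m s
    have h2 : (0 : ℝ) < 2 ^ m := by positivity
    constructor
    · rw [lt_div_iff₀ h2]; exact Int.lt_floor_add_one _
    · rw [div_le_iff₀ h2, add_mul, ← mul_pow]
      norm_num
      exact Int.floor_le _
  refine measurable_of_tendsto_metrizable
    (f := fun m (p : ℝ × Ω) => X (Set.projIcc 0 T hT (ρ m p.1)) p.2) (fun m => ?_) ?_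
  · have h1 : Measurable fun p : ℤ × Ω =>
        X (Set.projIcc 0 T hT ((p.1 + 1 : ℝ) / 2 ^ m)) p.2 :=
      measurable_from_prod_countable_right fun i => hX (Set.projIcc 0 T hT ((i + 1 : ℝ) / 2 ^ m))
    have h2 : Measurable fun p : ℝ × Ω => (⌊p.1 * 2 ^ m⌋, p.2) := by fun_prop
    have h3 := h1.comp h2
    simpa only [Function.comp_def] using h3
  · rw [tendsto_pi_nhds]
    rintro ⟨s, ω⟩
    refine (hrc ω (Set.projIcc 0 T hT s)).tendsto.comp ?_
    refine tendsto_nhdsWithin_iff.2 ⟨?_, Eventually.of_forall fun m => ?_⟩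
    · refine (continuous_projIcc.tendsto s).comp ?_
      refine tendsto_of_tendsto_of_tendsto_of_le_of_le tendsto_const_nhds
        (h := fun m => s + (1 / 2) ^ m) ?_ (fun m => (hρ m s).1.le) (fun m => (hρ m s).2)
      simpa using tendsto_const_nhds.add (tendsto_pow_atTop_nhds_zero_of_lt_one
        (by norm_num : (0 : ℝ) ≤ 1 / 2) (by norm_num))
    · exact Set.monotone_projIcc hT (hρ m s).1.le

/-! ### The second moment of a martingale of the form `f(t) - ∫₀ᵗ g(s) ds` -/

theorem integral_martingale_mul {ι Ω : Type*} [Preorder ι] {mΩ : MeasurableSpace Ω}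
    {P : Measure Ω} [IsProbabilityMeasure P] {ℱ : Filtration ι mΩ} {M : ι → Ω → ℝ}
    (hM : Martingale M ℱ P) {s t : ι} (hst : s ≤ t) {Z : Ω → ℝ} (hZ : StronglyMeasurable[ℱ s] Z)
    {C : ℝ} (hC : ∀ ω, |Z ω| ≤ C) :
    ∫ ω, Z ω * M t ω ∂P = ∫ ω, Z ω * M s ω ∂P := by
  have hi : Integrable (Z * M t) P :=
    (hM.integrable t).bdd_mul (hZ.mono (ℱ.le s)).aestronglyMeasurable
      (ae_of_all _ fun ω => by simpa using hC ω)
  have h1 := condExp_mul_of_stronglyMeasurable_left hZ hi (hM.integrable t)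
  have h2 := integral_condExp (ℱ.le s) (μ := P) (f := Z * M t)
  calc ∫ ω, Z ω * M t ω ∂P = ∫ ω, (P[Z * M t | ℱ s]) ω ∂P := h2.symm
    _ = ∫ ω, Z ω * M s ω ∂P := by
      refine integral_congr_ae ?_
      filter_upwards [h1, hM.2 s t hst] with ω h3 h4
      rw [h3, Pi.mul_apply, h4]

theorem rightCts_IccExtend {E : Type*} [TopologicalSpace E] {T : ℝ} (hT : 0 ≤ T)
    {x : Set.Icc (0 : ℝ) T → E} (hx : ∀ t, ContinuousWithinAt x (Set.Ici t) t) (t : ℝ) :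
    ContinuousWithinAt (Set.IccExtend hT x) (Set.Ici t) t :=
  (hx (Set.projIcc 0 T hT t)).comp continuous_projIcc.continuousWithinAt
    fun _ hs => Set.monotone_projIcc hT hs

theorem intervalIntegrable_of_abs_le {g : ℝ → ℝ} (hg : Measurable g) {C : ℝ}
    (hC : ∀ s, |g s| ≤ C) (a b : ℝ) : IntervalIntegrable g volume a b :=
  (intervalIntegrable_const (c := C)).mono_fun hg.aestronglyMeasurable
    (ae_of_all _ fun s => by simpa using (hC s).trans (le_abs_self C))

theorem abs_integral_le_mul {g : ℝ → ℝ} {C : ℝ} (hC : ∀ s, |g s| ≤ C) {t : ℝ}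
    (ht : 0 ≤ t) : |∫ s in (0 : ℝ)..t, g s| ≤ C * t := by
  have := intervalIntegral.norm_integral_le_of_norm_le_const (a := 0) (b := t) (f := g) (C := C)
    fun s _ => hC s
  simpa [abs_of_nonneg ht] using this

/-- The square of the primitive `G` of `g` has right derivative `2 G g`. Since `g` is only right
continuous, the fundamental theorem is used in its version for right derivatives. -/
theorem two_mul_integral_primitive_mul {g : ℝ → ℝ} (hg : Measurable g) {C : ℝ}
    (hC : ∀ s, |g s| ≤ C) (hrc : ∀ t, ContinuousWithinAt g (Set.Ici t) t) {T : ℝ} (hT : 0 ≤ T) :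
    2 * ∫ s in (0 : ℝ)..T, (∫ u in (0 : ℝ)..s, g u) * g s = (∫ s in (0 : ℝ)..T, g s) ^ 2 := by
  have hI := intervalIntegrable_of_abs_le hg hC
  have hcont : Continuous fun t => ∫ u in (0 : ℝ)..t, g u :=
    intervalIntegral.continuous_primitive hI 0
  have hd : ∀ t, HasDerivWithinAt (fun t => ∫ u in (0 : ℝ)..t, g u) (g t) (Set.Ioi t) t :=
    fun t => (intervalIntegral.integral_hasDerivWithinAt_right (hI 0 t)
      (s := Set.Ici t) (t := Set.Ioi t) hg.stronglyMeasurable.stronglyMeasurableAtFilter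
      ((hrc t).mono Set.Ioi_subset_Ici_self)).mono Set.Ioi_subset_Ici_self
  have hd2 : ∀ t ∈ Set.Ioo 0 T, HasDerivWithinAt (fun t => (∫ u in (0 : ℝ)..t, g u) ^ 2)
      (2 * ((∫ u in (0 : ℝ)..t, g u) * g t)) (Set.Ioi t) t := by
    intro t _
    have := (hd t).pow 2
    convert! this using 1
    norm_num
    ring
  have hint2 : IntervalIntegrable (fun t => 2 * ((∫ u in (0 : ℝ)..t, g u) * g t)) volume 0 T :=
    ((hI 0 T).continuousOn_mul hcont.continuousOn).const_mul 2
  have := intervalIntegral.integral_eq_sub_of_hasDeriv_right_of_le hT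
    (hcont.pow 2).continuousOn hd2 hint2
  rw [intervalIntegral.integral_const_mul] at this
  rw [this]
  simp

theorem integral_intervalIntegral_swap {Ω : Type*} {mΩ : MeasurableSpace Ω} {P : Measure Ω}
    [IsProbabilityMeasure P] {T : ℝ} (hT : 0 ≤ T) {φ : ℝ → Ω → ℝ}
    (hφ : Measurable (Function.uncurry φ)) {C : ℝ} (hC : ∀ s ω, |φ s ω| ≤ C) :
    ∫ ω, (∫ s in (0 : ℝ)..T, φ s ω) ∂P = ∫ s in (0 : ℝ)..T, ∫ ω, φ s ω ∂P := by
  simp_rw [intervalIntegral.integral_of_le hT]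
  refine (integral_integral_swap ?_).symm
  exact Integrable.of_bound hφ.aestronglyMeasurable C (ae_of_all _ fun p => hC p.1 p.2)

theorem integrable_of_abs_le {Ω : Type*} {mΩ : MeasurableSpace Ω} {P : Measure Ω}
    [IsProbabilityMeasure P] {φ : Ω → ℝ} (hφ : Measurable φ) {C : ℝ} (hC : ∀ ω, |φ ω| ≤ C) :
    Integrable φ P :=
  Integrable.of_bound hφ.aestronglyMeasurable C (ae_of_all _ hC)

theorem rightCts_sub_primitive {T : ℝ} (hT : 0 ≤ T) {f g : Set.Icc (0 : ℝ) T → ℝ}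
    (hf : ∀ t, ContinuousWithinAt f (Set.Ici t) t) (hg : Measurable (Set.IccExtend hT g)) {C : ℝ}
    (hC : ∀ t, |g t| ≤ C) (t : Set.Icc (0 : ℝ) T) :
    ContinuousWithinAt (fun t : Set.Icc (0 : ℝ) T => f t - ∫ s in (0 : ℝ)..t, Set.IccExtend hT g s)
      (Set.Ici t) t := by
  refine (hf t).sub (Continuous.continuousWithinAt ?_)
  exact (intervalIntegral.continuous_primitive
    (intervalIntegrable_of_abs_le hg fun s => hC _) 0).comp continuous_subtype_val

/-- Put `A_t = ∫₀ᵗ g` and `X = f - A`, so that `X_T² = f_T² - 2 A_T X_T - A_T²`. In the mean of `A_T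
X_T = ∫ g_s X_T ds` the martingale property replaces `X_T` by `X_s`, and `A_T² = 2 ∫ A_s g_s ds`;
together the corrections become `2 ∫ f g`. Hence `E (X_T - X_0)² = E ∫ (h - 2 f g)`, without any
quadratic variation. In the application `g` and `h` are the generator applied to `f` and `f²`, and
`h - 2 f g` is the carré du champ. -/
theorem integral_sq_martingale_increment_le {Ω : Type*} {mΩ : MeasurableSpace Ω} {P : Measure Ω}
    [IsProbabilityMeasure P] {T : ℝ} (hT : 0 ≤ T) {ℱ : Filtration (Set.Icc (0 : ℝ) T) mΩ}
    {f g h : Set.Icc (0 : ℝ) T → Ω → ℝ} {C γ : ℝ}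
    (hfm : ∀ t, Measurable[ℱ t] (f t)) (hgm : ∀ t, Measurable[ℱ t] (g t))
    (hhm : ∀ t, Measurable[ℱ t] (h t))
    (hfr : ∀ ω t, ContinuousWithinAt (fun t => f t ω) (Set.Ici t) t)
    (hgr : ∀ ω t, ContinuousWithinAt (fun t => g t ω) (Set.Ici t) t)
    (hhr : ∀ ω t, ContinuousWithinAt (fun t => h t ω) (Set.Ici t) t)
    (hfC : ∀ t ω, |f t ω| ≤ C) (hgC : ∀ t ω, |g t ω| ≤ C) (hhC : ∀ t ω, |h t ω| ≤ C)
    (hX : Martingale (fun (t : Set.Icc (0 : ℝ) T) ω => f t ω -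
      ∫ s in (0 : ℝ)..t, Set.IccExtend hT (fun s => g s ω) s) ℱ P)
    (hY : Martingale (fun (t : Set.Icc (0 : ℝ) T) ω => f t ω ^ 2 -
      ∫ s in (0 : ℝ)..t, Set.IccExtend hT (fun s => h s ω) s) ℱ P)
    (hγ : ∀ t ω, h t ω - 2 * f t ω * g t ω ≤ γ) :
    ∫ ω, (f ⟨T, Set.right_mem_Icc.2 hT⟩ ω -
      (∫ s in (0 : ℝ)..T, Set.IccExtend hT (fun s => g s ω) s) -
      f ⟨0, Set.left_mem_Icc.2 hT⟩ ω) ^ 2 ∂P ≤ γ * T := by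
  set e : Set.Icc (0 : ℝ) T := ⟨T, Set.right_mem_Icc.2 hT⟩ with he
  set z : Set.Icc (0 : ℝ) T := ⟨0, Set.left_mem_Icc.2 hT⟩ with hz
  have hze : z ≤ e := hT
  set X : Set.Icc (0 : ℝ) T → Ω → ℝ := fun t ω => f t ω -
      ∫ s in (0 : ℝ)..t, Set.IccExtend hT (fun s => g s ω) s with hXdef
  have hfm' : ∀ t, Measurable (f t) := fun t => (hfm t).mono (ℱ.le t) le_rfl
  have hgm' : ∀ t, Measurable (g t) := fun t => (hgm t).mono (ℱ.le t) le_rfl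
  have hhm' : ∀ t, Measurable (h t) := fun t => (hhm t).mono (ℱ.le t) le_rfl
  have hXm : ∀ t, Measurable (X t) := fun t =>
    ((hX.1 t).measurable).mono (ℱ.le t) le_rfl
  let p : ℝ → Set.Icc (0 : ℝ) T := Set.projIcc 0 T hT
  have jf : Measurable fun q : ℝ × Ω => f (p q.1) q.2 := measurable_uncurry_of_rightCts hT hfm' hfr
  have jg : Measurable fun q : ℝ × Ω => g (p q.1) q.2 := measurable_uncurry_of_rightCts hT hgm' hgr
  have jh : Measurable fun q : ℝ × Ω => h (p q.1) q.2 := measurable_uncurry_of_rightCts hT hhm' hhr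
  have sg : ∀ ω, Measurable fun s => g (p s) ω := fun ω => jg.comp measurable_prodMk_right
  have sf : ∀ ω, Measurable fun s => f (p s) ω := fun ω => jf.comp measurable_prodMk_right
  have sh : ∀ ω, Measurable fun s => h (p s) ω := fun ω => jh.comp measurable_prodMk_right
  have hXr : ∀ ω t, ContinuousWithinAt (fun t => X t ω) (Set.Ici t) t := fun ω t =>
    rightCts_sub_primitive hT (g := fun t => g t ω) (hfr ω) (sg ω) (fun t => hgC t ω) t
  have jX : Measurable fun q : ℝ × Ω => X (p q.1) q.2 := measurable_uncurry_of_rightCts hT hXm hXr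
  have sX : ∀ ω, Measurable fun s => X (p s) ω := fun ω => jX.comp measurable_prodMk_right
  have hC0 : ∀ _ : Ω, 0 ≤ C := fun ω => (abs_nonneg _).trans (hfC z ω)
  have hAC : ∀ (t : Set.Icc (0 : ℝ) T) ω, |∫ s in (0 : ℝ)..t, g (p s) ω| ≤ C * T := fun t ω =>
    (abs_integral_le_mul (fun s => hgC (p s) ω) t.2.1).trans
      (mul_le_mul_of_nonneg_left t.2.2 (hC0 ω))
  have hXC : ∀ t ω, |X t ω| ≤ C + C * T := fun t ω =>
    (abs_sub _ _).trans (add_le_add (hfC t ω) (hAC t ω))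
  set A : Ω → ℝ := fun ω => ∫ s in (0 : ℝ)..T, g (p s) ω with hA
  have hXe : ∀ ω, X e ω = f e ω - A ω := fun ω => rfl
  have hXz : ∀ ω, X z ω = f z ω := fun ω => by simp [hXdef, hz]
  have hAm : Measurable A := by
    have : A = fun ω => f e ω - X e ω := by funext ω; rw [hXe]; ring
    rw [this]
    exact (hfm' e).sub (hXm e)
  have hAC' : ∀ ω, |A ω| ≤ C * T := fun ω => hAC e ω
  have mulb : ∀ {a b A B : ℝ}, |a| ≤ A → |b| ≤ B → |a * b| ≤ A * B := fun ha hb => by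
    rw [abs_mul]; exact mul_le_mul ha hb (abs_nonneg _) ((abs_nonneg _).trans ha)
  -- the product of the martingale and the compensator
  have h1 : ∫ ω, A ω * X e ω ∂P = ∫ ω, (∫ s in (0 : ℝ)..T, g (p s) ω * X (p s) ω) ∂P := by
    have l1 : ∀ ω, A ω * X e ω = ∫ s in (0 : ℝ)..T, g (p s) ω * X e ω := fun ω => by
      rw [intervalIntegral.integral_mul_const]
    simp_rw [l1]
    rw [integral_intervalIntegral_swap hT (φ := fun s ω => g (p s) ω * X e ω)
        (jg.mul ((hXm e).comp measurable_snd)) (fun s ω => mulb (hgC _ ω) (hXC _ ω)),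
      integral_intervalIntegral_swap hT (φ := fun s ω => g (p s) ω * X (p s) ω)
        (jg.mul jX) (fun s ω => mulb (hgC _ ω) (hXC _ ω))]
    refine intervalIntegral.integral_congr fun s hs => ?_
    exact integral_martingale_mul hX (show p s ≤ e from (p s).2.2) (hgm (p s)).stronglyMeasurable
      (hgC (p s))
  have h2 : ∀ ω, A ω ^ 2 = 2 * ∫ s in (0 : ℝ)..T, (∫ u in (0 : ℝ)..s, g (p u) ω) * g (p s) ω :=
    fun ω => (two_mul_integral_primitive_mul (sg ω) (fun s => hgC _ ω)
      (rightCts_IccExtend hT (hgr ω)) hT).symm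
  -- Pointwise `X_s + A_s = f_s`, so the two compensator terms merge.
  have h3 : ∀ ω, 2 * (∫ s in (0 : ℝ)..T, g (p s) ω * X (p s) ω) + A ω ^ 2 =
      2 * ∫ s in (0 : ℝ)..T, f (p s) ω * g (p s) ω := by
    intro ω
    have hcont : Continuous fun t => ∫ u in (0 : ℝ)..t, g (p u) ω :=
      intervalIntegral.continuous_primitive
        (intervalIntegrable_of_abs_le (sg ω) fun s => hgC _ ω) 0
    rw [h2, ← mul_add, ← intervalIntegral.integral_add]
    · congr 1
      refine intervalIntegral.integral_congr fun s hs => ?_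
      rw [Set.uIcc_of_le hT] at hs
      have : X (p s) ω = f (p s) ω - ∫ u in (0 : ℝ)..s, g (p u) ω := by
        simp only [hXdef, p, Set.projIcc_of_mem hT hs]
        rfl
      simp only [this]
      ring
    · exact intervalIntegrable_of_abs_le ((sg ω).mul (sX ω))
        (fun s => mulb (hgC _ ω) (hXC _ ω)) _ _
    · exact (intervalIntegrable_of_abs_le (sg ω) (fun s => hgC _ ω) _ _).continuousOn_mul
        hcont.continuousOn
  -- The martingale of `f²` is compared at the times `0` and `T`.
  have h4 : ∫ ω, f e ω ^ 2 ∂P - ∫ ω, f z ω ^ 2 ∂P = ∫ ω, (∫ s in (0 : ℝ)..T, h (p s) ω) ∂P := by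
    have hYe := (integral_martingale_mul hY hze (Z := fun _ => 1) stronglyMeasurable_const
      (C := 1) (by simp)).symm
    simp only [one_mul] at hYe
    have hz0 : ∀ ω, (∫ s in (0 : ℝ)..z, Set.IccExtend hT (fun s => h s ω) s) = 0 := fun ω => by
      simp [hz]
    simp only [hz0, sub_zero] at hYe
    have hYi : Integrable (fun ω => f e ω ^ 2 - ∫ s in (0 : ℝ)..T, h (p s) ω) P := hY.integrable e
    have hfi : Integrable (fun ω => f e ω ^ 2) P :=
      integrable_of_abs_le ((hfm' e).pow_const 2) (C := C * C) fun ω => by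
        rw [sq]; exact mulb (hfC _ ω) (hfC _ ω)
    have hHi : Integrable (fun ω => ∫ s in (0 : ℝ)..T, h (p s) ω) P := by
      have := hfi.sub hYi
      refine this.congr (ae_of_all _ fun ω => ?_)
      simp
    rw [hYe]
    change _ - ∫ ω, (f e ω ^ 2 - ∫ s in (0 : ℝ)..T, h (p s) ω) ∂P = _
    rw [integral_sub hfi hHi]
    ring
  have h5 : ∫ ω, X z ω * X e ω ∂P = ∫ ω, X z ω * X z ω ∂P :=
    integral_martingale_mul hX hze (hX.1 z) (hXC z)
  have iX : ∀ s t, Integrable (fun ω => X s ω * X t ω) P := fun s t =>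
    integrable_of_abs_le ((hXm s).mul (hXm t)) fun ω => mulb (hXC _ ω) (hXC _ ω)
  have if2 : ∀ t, Integrable (fun ω => f t ω ^ 2) P := fun t =>
    integrable_of_abs_le ((hfm' t).pow_const 2) (C := C * C) fun ω => by
      rw [sq]; exact mulb (hfC _ ω) (hfC _ ω)
  have iAX : Integrable (fun ω => A ω * X e ω) P :=
    integrable_of_abs_le (hAm.mul (hXm e)) fun ω => mulb (hAC' ω) (hXC _ ω)
  have iA : Integrable (fun ω => A ω ^ 2) P :=
    integrable_of_abs_le (hAm.pow_const 2) (C := C * T * (C * T)) fun ω => by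
      rw [sq]; exact mulb (hAC' ω) (hAC' ω)
  have hI : ∀ ω, ∫ s in (0 : ℝ)..T, (h (p s) ω - 2 * f (p s) ω * g (p s) ω) ≤ γ * T := by
    intro ω
    calc _ ≤ ∫ s in (0 : ℝ)..T, γ := by
          refine intervalIntegral.integral_mono hT ?_ intervalIntegrable_const fun s => hγ _ ω
          refine (intervalIntegrable_of_abs_le (sh ω) (fun s => hhC _ ω) _ _).sub ?_
          refine intervalIntegrable_of_abs_le (((sf ω).const_mul 2).mul (sg ω))
            (C := 2 * C * C) (fun s => mulb ?_ (hgC _ ω)) _ _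
          rw [abs_mul, abs_two]
          exact mul_le_mul_of_nonneg_left (hfC _ ω) (by norm_num)
      _ = γ * T := by simp [mul_comm]
  have jfg : Measurable (fun ω => ∫ s in (0 : ℝ)..T, f (p s) ω * g (p s) ω) := by
    simp_rw [intervalIntegral.integral_of_le hT]
    exact ((jf.mul jg).stronglyMeasurable.integral_prod_left
      (μ := volume.restrict (Set.Ioc 0 T))).measurable
  have jh' : Measurable (fun ω => ∫ s in (0 : ℝ)..T, h (p s) ω) := by
    simp_rw [intervalIntegral.integral_of_le hT]
    exact (jh.stronglyMeasurable.integral_prod_left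
      (μ := volume.restrict (Set.Ioc 0 T))).measurable
  have jgX : Measurable (fun ω => ∫ s in (0 : ℝ)..T, g (p s) ω * X (p s) ω) := by
    simp_rw [intervalIntegral.integral_of_le hT]
    exact ((jg.mul jX).stronglyMeasurable.integral_prod_left
      (μ := volume.restrict (Set.Ioc 0 T))).measurable
  have iH : Integrable (fun ω => ∫ s in (0 : ℝ)..T, h (p s) ω) P :=
    integrable_of_abs_le jh' fun ω => abs_integral_le_mul (fun s => hhC _ ω) hT
  have iFG : Integrable (fun ω => ∫ s in (0 : ℝ)..T, f (p s) ω * g (p s) ω) P :=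
    integrable_of_abs_le jfg fun ω =>
      abs_integral_le_mul (fun s => mulb (hfC _ ω) (hgC _ ω)) hT
  have iGX : Integrable (fun ω => ∫ s in (0 : ℝ)..T, g (p s) ω * X (p s) ω) P :=
    integrable_of_abs_le jgX fun ω =>
      abs_integral_le_mul (fun s => mulb (hgC _ ω) (hXC _ ω)) hT
  have hpt : ∀ ω, ∫ s in (0 : ℝ)..T, (h (p s) ω - 2 * f (p s) ω * g (p s) ω) =
      (∫ s in (0 : ℝ)..T, h (p s) ω) - 2 * ∫ s in (0 : ℝ)..T, f (p s) ω * g (p s) ω := by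
    intro ω
    rw [← intervalIntegral.integral_const_mul, ← intervalIntegral.integral_sub]
    · refine intervalIntegral.integral_congr fun s _ => ?_
      ring
    · exact intervalIntegrable_of_abs_le (sh ω) (fun s => hhC _ ω) _ _
    · exact (intervalIntegrable_of_abs_le ((sf ω).mul (sg ω))
        (fun s => mulb (hfC _ ω) (hgC _ ω)) _ _).const_mul 2
  calc ∫ ω, (f e ω - (∫ s in (0 : ℝ)..T, g (p s) ω) - f z ω) ^ 2 ∂P
      = ∫ ω, (f e ω ^ 2 - 2 * (A ω * X e ω) - A ω ^ 2 - 2 * (X z ω * X e ω)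
          + X z ω * X z ω) ∂P := by
        refine integral_congr_ae (ae_of_all _ fun ω => ?_)
        simp only [hXe, hXz]
        ring
    _ = ∫ ω, f e ω ^ 2 ∂P - 2 * ∫ ω, A ω * X e ω ∂P - ∫ ω, A ω ^ 2 ∂P
          - 2 * ∫ ω, X z ω * X e ω ∂P + ∫ ω, X z ω * X z ω ∂P := by
        rw [integral_add, integral_sub, integral_sub, integral_sub, integral_const_mul,
          integral_const_mul]
        exacts [if2 e, iAX.const_mul 2, (if2 e).sub (iAX.const_mul 2), iA,
          ((if2 e).sub (iAX.const_mul 2)).sub iA, (iX z e).const_mul 2,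
          (((if2 e).sub (iAX.const_mul 2)).sub iA).sub ((iX z e).const_mul 2), iX z z]
    _ = ∫ ω, (∫ s in (0 : ℝ)..T, h (p s) ω) ∂P -
          ∫ ω, (2 * (∫ s in (0 : ℝ)..T, g (p s) ω * X (p s) ω) + A ω ^ 2) ∂P := by
        rw [h5, h1, ← h4, integral_add (iGX.const_mul 2) iA, integral_const_mul]
        have : ∫ ω, X z ω * X z ω ∂P = ∫ ω, f z ω ^ 2 ∂P := by
          refine integral_congr_ae (ae_of_all _ fun ω => ?_)
          simp only [hXz]
          ring
        rw [this]
        ring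
    _ = ∫ ω, (∫ s in (0 : ℝ)..T, (h (p s) ω - 2 * f (p s) ω * g (p s) ω)) ∂P := by
        simp_rw [h3, hpt]
        rw [← integral_sub iH (iFG.const_mul 2)]
    _ ≤ ∫ ω, γ * T ∂P := by
        refine integral_mono ?_ (integrable_const _) hI
        simp_rw [hpt]
        exact iH.sub (iFG.const_mul 2)
    _ = γ * T := by simp

/-! ### Sums over the files -/

theorem Storage.sum_servers {n L c : ℕ} (S : Storage n L c) (g : Finset (Fin n) → ℝ) :
    ∑ i, g (S.servers i) = c * ∑ A ∈ Finset.powersetCard L Finset.univ, g A := by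
  rw [← Finset.sum_fiberwise_of_maps_to (s := Finset.univ) (g := S.servers)
    (t := Finset.powersetCard L Finset.univ)
    (fun i _ => Finset.mem_powersetCard.2 ⟨Finset.subset_univ _, S.card_servers i⟩), Finset.mul_sum]
  refine Finset.sum_congr rfl fun A hA => ?_
  rw [Finset.sum_congr rfl (g := fun _ => g A) fun i hi => by rw [(Finset.mem_filter.1 hi).2],
    Finset.sum_const, S.card_files A (Finset.mem_powersetCard.1 hA).2, nsmul_eq_mul]

theorem Storage.numFiles_eq {n L c : ℕ} (S : Storage n L c) :
    (S.numFiles : ℝ) = c * n.choose L := by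
  have := S.sum_servers fun _ => 1
  simpa using this

/-- Each `L`-set is the server set of exactly `c` files, so `c` cancels and a uniform file amounts
to a uniform `L`-set. -/
theorem Storage.average_servers {n L c : ℕ} (hc : 1 ≤ c) (S : Storage n L c)
    (g : Finset (Fin n) → ℝ) :
    1 / (S.numFiles : ℝ) * ∑ i, g (S.servers i) =
      (∑ A ∈ Finset.powersetCard L Finset.univ, g A) / n.choose L := by
  rw [S.sum_servers, S.numFiles_eq]
  have : (c : ℝ) ≠ 0 := by positivity
  field_simp

theorem Storage.numFiles_pos {n L c : ℕ} (hc : 1 ≤ c) (hn : L ≤ n) (S : Storage n L c) :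
    0 < (S.numFiles : ℝ) := by
  rw [S.numFiles_eq]
  have := Nat.choose_pos hn
  positivity

/-! ### The number of jobs sent to queues of a given length -/

/-- The number of jobs that a request for the servers of `A` sends to queues of length `j`. -/
def routed {n : ℕ} (k : ℕ) (q : Fin n → ℕ) (j : ℕ) (A : Finset (Fin n)) : ℕ :=
  min (A.filter fun i => q i = j).card (k - (A.filter fun i => q i < j).card)

/-- If some server of `A` outside `B` has a queue shorter than `j`, then so have all `k` servers of
`B`. Otherwise `B` contains every such server of `A`. -/
theorem IsShortest.card_filter_lt {n k : ℕ} {q : Fin n → ℕ} {A B : Finset (Fin n)}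
    (h : IsShortest k q A B) (j : ℕ) :
    (B.filter fun i => q i < j).card = min k (A.filter fun i => q i < j).card := by
  obtain ⟨hBA, hcard, hmin⟩ := h
  have hle := Finset.card_le_card (Finset.filter_subset_filter (fun i => q i < j) hBA)
  have hle' := Finset.card_filter_le B (fun i => q i < j)
  by_cases hex : ∃ a ∈ A \ B, q a < j
  · obtain ⟨a, ha, haj⟩ := hex
    have : B.filter (fun i => q i < j) = B :=
      Finset.filter_true_of_mem fun i hi => (hmin i hi a ha).trans_lt haj
    rw [this] at hle ⊢
    omega
  · push Not at hex
    have : A.filter (fun i => q i < j) = B.filter fun i => q i < j := by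
      ext i
      simp only [Finset.mem_filter]
      refine ⟨fun hi => ⟨?_, hi.2⟩, fun hi => ⟨hBA hi.1, hi.2⟩⟩
      by_contra hB
      exact absurd hi.2 (not_lt.2 (hex i (Finset.mem_sdiff.2 ⟨hi.1, hB⟩)))
    rw [this]
    omega

theorem card_filter_lt_succ {n : ℕ} (q : Fin n → ℕ) (A : Finset (Fin n)) (j : ℕ) :
    (A.filter fun i => q i < j + 1).card =
      (A.filter fun i => q i < j).card + (A.filter fun i => q i = j).card := by
  rw [← Finset.card_union_of_disjoint]
  · congr 1
    ext i
    simp only [Finset.mem_filter, Finset.mem_union]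
    grind
  · rw [Finset.disjoint_filter]
    grind

/-- The difference of the previous count at `j + 1` and `j`. The right side does not involve `B`:
tie-breaking cannot influence the empirical measure. -/
theorem IsShortest.card_filter_eq {n k : ℕ} {q : Fin n → ℕ} {A B : Finset (Fin n)}
    (h : IsShortest k q A B) (j : ℕ) : (B.filter fun i => q i = j).card = routed k q j A := by
  have h1 := h.card_filter_lt j
  have h2 := h.card_filter_lt (j + 1)
  rw [card_filter_lt_succ, card_filter_lt_succ] at h2
  unfold routed
  omega

/-! ### The generator applied to the empirical measure -/

theorem empirical_apply {n : ℕ} (hn : 0 < n) (q : Fin n → ℕ) (j : ℕ) :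
    empirical q j = (1 / (n : ℝ)) * ∑ i, if q i = j then 1 else 0 := by
  simp [empirical, hn.ne']

theorem empirical_eq_card {n : ℕ} (hn : 0 < n) (q : Fin n → ℕ) (j : ℕ) :
    empirical q j = ((Finset.univ.filter fun i => q i = j).card : ℝ) / n := by
  rw [empirical_apply hn, Finset.sum_boole]
  ring

theorem empirical_arrive_sub {n : ℕ} (hn : 0 < n) (q : Fin n → ℕ) (B : Finset (Fin n)) (j : ℕ) :
    empirical (arrive q B) j - empirical q j =
      (1 / (n : ℝ)) * (((B.filter fun i => q i + 1 = j).card : ℝ) -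
        (B.filter fun i => q i = j).card) := by
  rw [empirical_apply hn, empirical_apply hn, ← mul_sub, ← Finset.sum_sub_distrib,
    ← Finset.sum_boole, ← Finset.sum_boole, ← Finset.sum_sub_distrib]
  congr 1
  rw [← Finset.sum_subset (Finset.subset_univ B)]
  · exact Finset.sum_congr rfl fun i hi => by simp [arrive, hi]
  · intro i _ hi
    simp [arrive, hi]

theorem empirical_depart_sub {n : ℕ} (hn : 0 < n) (q : Fin n → ℕ) (i : Fin n) (j : ℕ) :
    empirical (depart q i) j - empirical q j =
      (1 / (n : ℝ)) * ((if q i - 1 = j then 1 else 0) - if q i = j then 1 else 0) := by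
  rw [empirical_apply hn, empirical_apply hn, ← mul_sub, ← Finset.sum_sub_distrib]
  congr 1
  rw [Finset.sum_eq_single i]
  · simp [depart]
  · intro l _ hl
    simp [depart, hl]
  · simp

/-- The mean number of jobs that a request sends to queues of length `j`. -/
def meanRouted {n : ℕ} (L k : ℕ) (q : Fin n → ℕ) (j : ℕ) : ℝ :=
  (∑ A ∈ Finset.powersetCard L Finset.univ, (routed k q j A : ℝ)) / n.choose L

theorem sum_depart_empirical {n : ℕ} (hn : 0 < n) (k : ℕ) (q : Fin n → ℕ) (j : ℕ) :
    ∑ i, (if 0 < q i then (k : ℝ) * (empirical (depart q i) j - empirical q j) else 0) =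
      k * (empirical q (j + 1) - empirical q j) + if j = 0 then (k : ℝ) * empirical q 0 else 0 := by
  -- For `q i > 0` the truncated `q i - 1` equals `j` exactly if `q i = j + 1`. Empty queues do not
  -- depart, which the term for `j = 0` restores.
  have h1 : ∀ i, (if 0 < q i then (k : ℝ) * (empirical (depart q i) j - empirical q j) else 0) =
      k * (1 / (n : ℝ)) * ((if q i = j + 1 then 1 else 0) - (if q i = j then 1 else 0) +
        if j = 0 then (if q i = 0 then 1 else 0) else 0) := by
    intro i
    rw [empirical_depart_sub hn, mul_assoc]
    split_ifs <;> first | omega | simp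
  rw [Finset.sum_congr rfl fun i _ => h1 i, ← Finset.mul_sum, Finset.sum_add_distrib,
    Finset.sum_sub_distrib, empirical_apply hn, empirical_apply hn, empirical_apply hn]
  split_ifs
  · ring
  · simp only [Finset.sum_const_zero]
    ring

/-- All sets `B` that the routing can choose for `A` produce the same jump, so the average over `B`
only uses that the probabilities sum to one. -/
theorem generator_empirical {n L c k : ℕ} (hc : 1 ≤ c) (hn : 0 < n) (lam : ℝ)
    (S : Storage n L c) (R : Routing n L k) (j : ℕ) (q : Fin n → ℕ) :
    generator k lam S R (fun q => empirical q j) q =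
      lam * ((if j = 0 then 0 else meanRouted L k q (j - 1)) - meanRouted L k q j) +
        k * (empirical q (j + 1) - empirical q j) +
        if j = 0 then (k : ℝ) * empirical q 0 else 0 := by
  have hn' : (n : ℝ) ≠ 0 := by positivity
  have h1 : ∀ A : Finset (Fin n), A.card = L →
      ∑ B, R.prob q A B * (empirical (arrive q B) j - empirical q j) =
      (1 / (n : ℝ)) * ((if j = 0 then 0 else (routed k q (j - 1) A : ℝ)) - routed k q j A) := by
    intro A hA
    have h2 : ∀ B, R.prob q A B * (empirical (arrive q B) j - empirical q j) = R.prob q A B *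
        ((1 / (n : ℝ)) *
          ((if j = 0 then 0 else (routed k q (j - 1) A : ℝ)) - routed k q j A)) := by
      intro B
      by_cases hB : R.prob q A B = 0
      · simp [hB]
      · have hs := R.shortest q A B hA hB
        rw [empirical_arrive_sub hn, hs.card_filter_eq]
        congr 3
        split_ifs with hj
        · simp [hj]
        · rw [← hs.card_filter_eq]
          congr 3
          ext i
          omega
    rw [Finset.sum_congr rfl fun B _ => h2 B, ← Finset.sum_mul, R.sum_eq_one q A hA, one_mul]
  unfold generator
  rw [sum_depart_empirical hn, Finset.sum_congr rfl fun i _ => h1 _ (S.card_servers i),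
    S.average_servers hc fun A => (1 / (n : ℝ)) *
      ((if j = 0 then 0 else (routed k q (j - 1) A : ℝ)) - routed k q j A), ← Finset.mul_sum,
    Finset.sum_sub_distrib, ← add_assoc]
  congr 2
  unfold meanRouted
  split_ifs
  · simp only [Finset.sum_const_zero]
    field_simp
    ring
  · field_simp

/-! ### Hypergeometric and multinomial probabilities -/

/-- A set of servers is the disjoint union of its parts with queues shorter than, equal to and
longer than `j`, and these are chosen independently: the multivariate hypergeometric count. -/
theorem card_powersetCard_filter {n : ℕ} (q : Fin n → ℕ) (j i₁ i₂ i₃ : ℕ) :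
    ((Finset.powersetCard (i₁ + i₂ + i₃) (Finset.univ : Finset (Fin n))).filter fun A =>
      (A.filter fun i => q i < j).card = i₁ ∧ (A.filter fun i => q i = j).card = i₂).card =
    (Finset.univ.filter fun i => q i < j).card.choose i₁ *
      ((Finset.univ.filter fun i => q i = j).card.choose i₂ *
        (Finset.univ.filter fun i => j < q i).card.choose i₃) := by
  rw [← Finset.card_powersetCard, ← Finset.card_powersetCard, ← Finset.card_powersetCard,
    ← Finset.card_product, ← Finset.card_product]
  have hsplit : ∀ A : Finset (Fin n), A = (A.filter fun i => q i < j) ∪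
      ((A.filter fun i => q i = j) ∪ A.filter fun i => j < q i) := by
    intro A
    ext i
    simp only [Finset.mem_union, Finset.mem_filter]
    grind
  have hcard : ∀ A : Finset (Fin n), A.card = (A.filter fun i => q i < j).card +
      ((A.filter fun i => q i = j).card + (A.filter fun i => j < q i).card) := by
    intro A
    conv_lhs => rw [hsplit A]
    rw [Finset.card_union_of_disjoint, Finset.card_union_of_disjoint]
    · rw [Finset.disjoint_filter]; grind
    · rw [← Finset.filter_or, Finset.disjoint_filter]; grind
  have hback : ∀ U V W : Finset (Fin n), (U ⊆ Finset.univ.filter fun i => q i < j) →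
      (V ⊆ Finset.univ.filter fun i => q i = j) → (W ⊆ Finset.univ.filter fun i => j < q i) →
      (U ∪ (V ∪ W)).filter (fun i => q i < j) = U ∧
      (U ∪ (V ∪ W)).filter (fun i => q i = j) = V ∧
      (U ∪ (V ∪ W)).filter (fun i => j < q i) = W := by
    intro U V W hU hV hW
    have hU' : ∀ i ∈ U, q i < j := fun i hi => (Finset.mem_filter.1 (hU hi)).2
    have hV' : ∀ i ∈ V, q i = j := fun i hi => (Finset.mem_filter.1 (hV hi)).2
    have hW' : ∀ i ∈ W, j < q i := fun i hi => (Finset.mem_filter.1 (hW hi)).2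
    refine ⟨?_, ?_, ?_⟩ <;> ext i <;> have := hU' i <;> have := hV' i <;> have := hW' i <;>
      simp only [Finset.mem_filter, Finset.mem_union] <;> grind
  refine Finset.card_nbij'
    (fun A => (A.filter fun i => q i < j, A.filter fun i => q i = j, A.filter fun i => j < q i))
    (fun p => p.1 ∪ (p.2.1 ∪ p.2.2)) ?_ ?_ ?_ ?_
  · intro A hA
    simp only [Finset.coe_filter, Finset.mem_powersetCard, Set.mem_ofPred_eq] at hA
    have := hcard A
    simp only [Finset.coe_product, Set.mem_prod, Finset.mem_coe, Finset.mem_powersetCard]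
    refine ⟨⟨Finset.filter_subset_filter _ (Finset.subset_univ _), hA.2.1⟩,
      ⟨Finset.filter_subset_filter _ (Finset.subset_univ _), hA.2.2⟩,
      Finset.filter_subset_filter _ (Finset.subset_univ _), by omega⟩
  · rintro ⟨U, V, W⟩ h
    simp only [Finset.coe_product, Set.mem_prod, Finset.mem_coe, Finset.mem_powersetCard] at h
    obtain ⟨⟨hU, hU'⟩, ⟨hV, hV'⟩, hW, hW'⟩ := h
    obtain ⟨e1, e2, e3⟩ := hback U V W hU hV hW
    have := hcard (U ∪ (V ∪ W))
    simp only [Finset.coe_filter, Finset.mem_powersetCard, Set.mem_ofPred_eq]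
    rw [e1, e2, e3] at this
    rw [e1, e2]
    exact ⟨⟨Finset.subset_univ _, by omega⟩, hU', hV'⟩
  · intro A _
    exact (hsplit A).symm
  · rintro ⟨U, V, W⟩ h
    simp only [Finset.coe_product, Set.mem_prod, Finset.mem_coe, Finset.mem_powersetCard] at h
    obtain ⟨⟨hU, hU'⟩, ⟨hV, hV'⟩, hW, hW'⟩ := h
    obtain ⟨e1, e2, e3⟩ := hback U V W hU hV hW
    exact Prod.ext e1 (Prod.ext e2 e3)

/-! ### The polynomial that defines `ζ̄` -/

/-- The coefficients of the polynomial that defines `ζ̄`. -/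
def zetaCoeff (L k i₁ i₂ : ℕ) : ℝ :=
  (min i₂ (k - i₁) : ℕ) /
    ((i₁.factorial : ℝ) * (i₂.factorial : ℝ) * ((L - i₁ - i₂).factorial : ℝ))

/-- The polynomial that defines `ζ̄`. -/
def zetaPoly (L k : ℕ) (a b d : ℝ) : ℝ :=
  ∑ i₁ ∈ Finset.range k, ∑ i₂ ∈ Finset.Icc 1 (L - i₁),
    zetaCoeff L k i₁ i₂ * (a ^ i₁ * b ^ i₂ * d ^ (L - i₁ - i₂))

/-- The sum of the coefficients of the polynomial that defines `ζ̄`. -/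
def zetaMass (L k : ℕ) : ℝ :=
  ∑ i₁ ∈ Finset.range k, ∑ i₂ ∈ Finset.Icc 1 (L - i₁), zetaCoeff L k i₁ i₂

theorem zetaCoeff_nonneg (L k i₁ i₂ : ℕ) : 0 ≤ zetaCoeff L k i₁ i₂ := by
  unfold zetaCoeff
  positivity

theorem zetaMass_nonneg (L k : ℕ) : 0 ≤ zetaMass L k :=
  Finset.sum_nonneg fun _ _ => Finset.sum_nonneg fun _ _ => zetaCoeff_nonneg _ _ _ _

theorem zetaBar_eq_zetaPoly (L k j : ℕ) (r : ℕ → ℝ) :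
    zetaBar L k j r =
      zetaPoly L k (∑ m ∈ Finset.range j, r m) (r j) (∑' m, r (j + 1 + m)) := by
  unfold zetaBar zetaPoly zetaCoeff
  refine Finset.sum_congr rfl fun i₁ _ => ?_
  rw [Finset.mul_sum]
  refine Finset.sum_congr rfl fun i₂ _ => ?_
  field_simp

theorem abs_mul_mul_sub_le {x y z x' y' z' : ℝ} (hy : 0 ≤ y ∧ y ≤ 1)
    (hz : 0 ≤ z ∧ z ≤ 1) (hx' : 0 ≤ x' ∧ x' ≤ 1) (hy' : 0 ≤ y' ∧ y' ≤ 1) :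
    |x * y * z - x' * y' * z'| ≤ |x - x'| + |y - y'| + |z - z'| := by
  have h : x * y * z - x' * y' * z' =
      (x - x') * (y * z) + (y - y') * (x' * z) + (z - z') * (x' * y') := by ring
  have aux : ∀ u v w : ℝ, 0 ≤ v ∧ v ≤ 1 → 0 ≤ w ∧ w ≤ 1 → |u * (v * w)| ≤ |u| := by
    intro u v w hv hw
    rw [abs_mul, abs_of_nonneg (mul_nonneg hv.1 hw.1)]
    exact mul_le_of_le_one_right (abs_nonneg _) (mul_le_one₀ hv.2 hw.1 hw.2)
  rw [h]
  refine (abs_add_three _ _ _).trans ?_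
  exact add_le_add (add_le_add (aux _ _ _ hy hz) (aux _ _ _ hx' hz)) (aux _ _ _ hx' hy')

theorem abs_pow_sub_pow_le_mul {x y : ℝ} (hx : 0 ≤ x ∧ x ≤ 1) (hy : 0 ≤ y ∧ y ≤ 1) (i : ℕ) :
    |x ^ i - y ^ i| ≤ i * |x - y| := by
  induction i with
  | zero => simp
  | succ i ih =>
    have h : x ^ (i + 1) - y ^ (i + 1) = (x ^ i - y ^ i) * x + y ^ i * (x - y) := by ring
    have h1 : |(x ^ i - y ^ i) * x| ≤ i * |x - y| := by
      rw [abs_mul, abs_of_nonneg hx.1]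
      exact (mul_le_of_le_one_right (abs_nonneg _) hx.2).trans ih
    have h2 : |y ^ i * (x - y)| ≤ |x - y| := by
      rw [abs_mul, abs_of_nonneg (pow_nonneg hy.1 i)]
      exact mul_le_of_le_one_left (abs_nonneg _) (pow_le_one₀ hy.1 hy.2)
    rw [h]
    push_cast
    linarith [abs_add_le ((x ^ i - y ^ i) * x) (y ^ i * (x - y))]

theorem pow_mem_unit {x : ℝ} (hx : 0 ≤ x ∧ x ≤ 1) (i : ℕ) : 0 ≤ x ^ i ∧ x ^ i ≤ 1 :=
  ⟨pow_nonneg hx.1 i, pow_le_one₀ hx.1 hx.2⟩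

theorem abs_zetaPoly_sub_le (L k : ℕ) (hkL : k ≤ L) {a b d a' b' d' : ℝ} (ha : 0 ≤ a ∧ a ≤ 1)
    (hb : 0 ≤ b ∧ b ≤ 1) (hd : 0 ≤ d ∧ d ≤ 1) (ha' : 0 ≤ a' ∧ a' ≤ 1) (hb' : 0 ≤ b' ∧ b' ≤ 1)
    (hd' : 0 ≤ d' ∧ d' ≤ 1) :
    |zetaPoly L k a b d - zetaPoly L k a' b' d'| ≤
      zetaMass L k * (L * (|a - a'| + |b - b'| + |d - d'|)) := by
  unfold zetaPoly zetaMass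
  rw [← Finset.sum_sub_distrib, Finset.sum_mul]
  refine (Finset.abs_sum_le_sum_abs _ _).trans (Finset.sum_le_sum fun i₁ h₁ => ?_)
  rw [← Finset.sum_sub_distrib, Finset.sum_mul]
  refine (Finset.abs_sum_le_sum_abs _ _).trans (Finset.sum_le_sum fun i₂ h₂ => ?_)
  rw [← mul_sub, abs_mul, abs_of_nonneg (zetaCoeff_nonneg _ _ _ _)]
  refine mul_le_mul_of_nonneg_left ?_ (zetaCoeff_nonneg _ _ _ _)
  refine (abs_mul_mul_sub_le (pow_mem_unit hb _) (pow_mem_unit hd _) (pow_mem_unit ha' _)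
    (pow_mem_unit hb' _)).trans ?_
  have l1 : (i₁ : ℝ) ≤ L := by exact_mod_cast (Finset.mem_range.1 h₁).le.trans hkL
  have l2 : (i₂ : ℝ) ≤ L := by
    exact_mod_cast (Finset.mem_Icc.1 h₂).2.trans (Nat.sub_le _ _)
  have l3 : ((L - i₁ - i₂ : ℕ) : ℝ) ≤ L := by
    exact_mod_cast (Nat.sub_le _ _).trans (Nat.sub_le _ _)
  rw [mul_add, mul_add]
  gcongr
  · exact (abs_pow_sub_pow_le_mul ha ha' _).trans (mul_le_mul_of_nonneg_right l1 (abs_nonneg _))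
  · exact (abs_pow_sub_pow_le_mul hb hb' _).trans (mul_le_mul_of_nonneg_right l2 (abs_nonneg _))
  · exact (abs_pow_sub_pow_le_mul hd hd' _).trans (mul_le_mul_of_nonneg_right l3 (abs_nonneg _))

theorem zetaPoly_nonneg (L k : ℕ) {a b d : ℝ} (ha : 0 ≤ a) (hb : 0 ≤ b) (hd : 0 ≤ d) :
    0 ≤ zetaPoly L k a b d :=
  Finset.sum_nonneg fun _ _ => Finset.sum_nonneg fun _ _ =>
    mul_nonneg (zetaCoeff_nonneg _ _ _ _) (by positivity)

/-- Since `i₂ ≥ 1`, every monomial keeps a factor `b`. This linear bound yields the `ℓ₁` bound of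
the drift and, later, the vanishing of the flux to infinity. -/
theorem zetaPoly_le (L k : ℕ) {a b d : ℝ} (ha : 0 ≤ a ∧ a ≤ 1) (hb : 0 ≤ b ∧ b ≤ 1)
    (hd : 0 ≤ d ∧ d ≤ 1) : zetaPoly L k a b d ≤ zetaMass L k * b := by
  unfold zetaPoly zetaMass
  rw [Finset.sum_mul]
  refine Finset.sum_le_sum fun i₁ _ => ?_
  rw [Finset.sum_mul]
  refine Finset.sum_le_sum fun i₂ h₂ => mul_le_mul_of_nonneg_left ?_ (zetaCoeff_nonneg _ _ _ _)
  have h1 : b ^ i₂ ≤ b := pow_le_of_le_one hb.1 hb.2 (by have := (Finset.mem_Icc.1 h₂).1; omega)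
  calc a ^ i₁ * b ^ i₂ * d ^ (L - i₁ - i₂) ≤ 1 * b * 1 := by
        refine mul_le_mul (mul_le_mul (pow_mem_unit ha _).2 h1 (pow_mem_unit hb _).1 zero_le_one)
          (pow_mem_unit hd _).2 (pow_mem_unit hd _).1 (by linarith [hb.1])
    _ = b := by ring

/-! ### Sampling without and with replacement -/

/-- Factor number `i` is `(a - i) / n`, which differs from `a / n` by at most `i / n`, also for `i >
a`, where the truncated difference is `0`. The errors add up because all factors are at most one. -/
theorem abs_descFactorial_div_sub_le {a n : ℕ} (hn : 0 < n) (ha : a ≤ n) (i : ℕ) :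
    |(a.descFactorial i : ℝ) / n ^ i - (a / n : ℝ) ^ i| ≤ i ^ 2 / n := by
  have hn' : (0 : ℝ) < n := by exact_mod_cast hn
  have ha' : (0 : ℝ) ≤ a / n ∧ (a / n : ℝ) ≤ 1 :=
    ⟨by positivity, (div_le_one hn').2 (by exact_mod_cast ha)⟩
  induction i with
  | zero => simp
  | succ i ih =>
    have h1 : ((a - i : ℕ) : ℝ) ≤ a := by exact_mod_cast Nat.sub_le _ _
    have h2 : (a : ℝ) ≤ ((a - i : ℕ) : ℝ) + i := by exact_mod_cast (by omega : a ≤ a - i + i)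
    have hx : |((a - i : ℕ) : ℝ) / n - a / n| ≤ i / n := by
      rw [← sub_div, abs_div, abs_of_pos hn']
      gcongr
      rw [abs_le]
      constructor <;> linarith
    have hx1 : |((a - i : ℕ) : ℝ) / n| ≤ 1 := by
      rw [abs_of_nonneg (by positivity), div_le_one hn']
      exact h1.trans (by exact_mod_cast ha)
    have h : ((a.descFactorial (i + 1) : ℕ) : ℝ) / n ^ (i + 1) - (a / n : ℝ) ^ (i + 1) =
        ((a - i : ℕ) : ℝ) / n * ((a.descFactorial i : ℝ) / n ^ i - (a / n : ℝ) ^ i) +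
          (a / n : ℝ) ^ i * (((a - i : ℕ) : ℝ) / n - a / n) := by
      rw [Nat.descFactorial_succ, Nat.cast_mul, pow_succ, pow_succ]
      field_simp
      ring
    rw [h]
    refine (abs_add_le _ _).trans ?_
    rw [abs_mul, abs_mul, abs_of_nonneg (pow_nonneg ha'.1 i)]
    have e1 := (mul_le_of_le_one_left (abs_nonneg
      ((a.descFactorial i : ℝ) / n ^ i - (a / n : ℝ) ^ i)) hx1).trans ih
    have e2 := (mul_le_of_le_one_left (abs_nonneg
      (((a - i : ℕ) : ℝ) / n - a / n)) (pow_le_one₀ ha'.1 ha'.2 (n := i))).trans hx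
    refine (add_le_add e1 e2).trans ?_
    rw [← add_div]
    push_cast
    gcongr
    nlinarith [(Nat.cast_nonneg i : (0 : ℝ) ≤ i)]

theorem descFactorial_div_mem_unit {a n : ℕ} (hn : 0 < n) (ha : a ≤ n) (i : ℕ) :
    (0 : ℝ) ≤ (a.descFactorial i : ℝ) / n ^ i ∧ (a.descFactorial i : ℝ) / n ^ i ≤ 1 := by
  refine ⟨by positivity, ?_⟩
  rw [div_le_one (by positivity)]
  exact_mod_cast (Nat.descFactorial_le_pow a i).trans (Nat.pow_le_pow_left ha i)

/-- Let `ρ` be the hypergeometric probability and `y = n (n-1) ⋯ (n-N+1) / nᴺ`. Then `ρ y` is the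
multinomial expression with powers replaced by falling factorials. The error splits into `ρ (1 -
y)`, where `ρ ≤ 1`, and three replacements of a falling factorial by a power, each of order `N² /
n`. -/
theorem abs_hypergeometric_sub_le {n a b d i₁ i₂ i₃ : ℕ} (hn : i₁ + i₂ + i₃ ≤ n) (hn0 : 0 < n)
    (hab : a ≤ n) (hb : b ≤ n) (hd : d ≤ n)
    (hle : a.choose i₁ * (b.choose i₂ * d.choose i₃) ≤ n.choose (i₁ + i₂ + i₃)) :
    |((a.choose i₁ * (b.choose i₂ * d.choose i₃) : ℕ) : ℝ) / n.choose (i₁ + i₂ + i₃) -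
      (i₁ + i₂ + i₃).factorial / ((i₁.factorial : ℝ) * i₂.factorial * i₃.factorial) *
        ((a / n : ℝ) ^ i₁ * (b / n : ℝ) ^ i₂ * (d / n : ℝ) ^ i₃)| ≤
      (1 + 3 * (i₁ + i₂ + i₃).factorial) * (i₁ + i₂ + i₃ : ℕ) ^ 2 / n := by
  set N := i₁ + i₂ + i₃ with hN
  have hn' : (0 : ℝ) < n := by exact_mod_cast hn0
  set ρ : ℝ := ((a.choose i₁ * (b.choose i₂ * d.choose i₃) : ℕ) : ℝ) / n.choose N with hρ
  set y : ℝ := (n.descFactorial N : ℝ) / n ^ N with hy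
  have hchoose : (0 : ℝ) < n.choose N := by exact_mod_cast Nat.choose_pos hn
  have hρ1 : |ρ| ≤ 1 := by
    rw [abs_of_nonneg (by positivity), div_le_one hchoose]
    exact_mod_cast hle
  set x₁ : ℝ := (a.descFactorial i₁ : ℝ) / n ^ i₁ with hx₁
  set x₂ : ℝ := (b.descFactorial i₂ : ℝ) / n ^ i₂ with hx₂
  set x₃ : ℝ := (d.descFactorial i₃ : ℝ) / n ^ i₃ with hx₃
  set κ : ℝ := N.factorial / ((i₁.factorial : ℝ) * i₂.factorial * i₃.factorial) with hκ
  have hκ0 : 0 ≤ κ := by positivity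
  have hκ1 : κ ≤ N.factorial := by
    refine div_le_self (by positivity) ?_
    exact_mod_cast Nat.one_le_iff_ne_zero.2 (by positivity)
  have hprod : ρ * y = κ * (x₁ * x₂ * x₃) := by
    simp only [hρ, hy, hκ, hx₁, hx₂, hx₃, Nat.descFactorial_eq_factorial_mul_choose, Nat.cast_mul]
    rw [hN, pow_add, pow_add, ← hN]
    field_simp
  have hy1 : |1 - y| ≤ (N : ℝ) ^ 2 / n := by
    have := abs_descFactorial_div_sub_le hn0 (le_refl n) N
    rw [div_self hn'.ne', one_pow, abs_sub_comm] at this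
    exact this
  have ua : (0 : ℝ) ≤ a / n ∧ (a / n : ℝ) ≤ 1 :=
    ⟨by positivity, (div_le_one hn').2 (by exact_mod_cast hab)⟩
  have ub : (0 : ℝ) ≤ b / n ∧ (b / n : ℝ) ≤ 1 :=
    ⟨by positivity, (div_le_one hn').2 (by exact_mod_cast hb)⟩
  have step := abs_mul_mul_sub_le (x := x₁) (y := x₂) (z := x₃) (z' := (d / n : ℝ) ^ i₃)
    (descFactorial_div_mem_unit hn0 hb i₂)
    (descFactorial_div_mem_unit hn0 hd i₃) (pow_mem_unit ua i₁) (pow_mem_unit ub i₂)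
  have sq : ∀ i : ℕ, i ≤ N → (i : ℝ) ^ 2 / n ≤ (N : ℝ) ^ 2 / n := fun i hi => by
    have : (i : ℝ) ≤ N := by exact_mod_cast hi
    gcongr
  have e1 := (abs_descFactorial_div_sub_le hn0 hab i₁).trans (sq i₁ (by omega))
  have e2 := (abs_descFactorial_div_sub_le hn0 hb i₂).trans (sq i₂ (by omega))
  have e3 := (abs_descFactorial_div_sub_le hn0 hd i₃).trans (sq i₃ (by omega))
  have hid : ρ - κ * ((a / n : ℝ) ^ i₁ * (b / n : ℝ) ^ i₂ * (d / n : ℝ) ^ i₃) = ρ * (1 - y) +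
      κ * (x₁ * x₂ * x₃ - (a / n : ℝ) ^ i₁ * (b / n : ℝ) ^ i₂ * (d / n : ℝ) ^ i₃) := by
    linear_combination hprod
  rw [hid]
  refine (abs_add_le _ _).trans ?_
  rw [abs_mul, abs_mul, abs_of_nonneg hκ0]
  calc _ ≤ 1 * ((N : ℝ) ^ 2 / n) + N.factorial * (3 * ((N : ℝ) ^ 2 / n)) := by
        gcongr
        linarith
    _ = _ := by ring

/-! ### The empirical measure and the mean number of jobs per queue length -/

/-- This removes the infinite sum from `ζ̄`: on the simplex it becomes a polynomial in finitely many
coordinates, hence continuous under coordinatewise convergence. -/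
theorem Simplex.tsum_tail (s : Simplex) (j : ℕ) :
    ∑' m, s (j + 1 + m) = 1 - ∑ m ∈ Finset.range (j + 1), s m := by
  have h := s.hasSum.summable.sum_add_tsum_nat_add (j + 1)
  rw [s.hasSum.tsum_eq] at h
  simp_rw [add_comm (j + 1)]
  linarith

theorem sum_range_empirical {n : ℕ} (hn : 0 < n) (q : Fin n → ℕ) (j : ℕ) :
    ∑ m ∈ Finset.range j, empirical q m =
      ((Finset.univ.filter fun i => q i < j).card : ℝ) / n := by
  induction j with
  | zero => simp
  | succ j ih =>
    rw [Finset.sum_range_succ, ih, empirical_eq_card hn, card_filter_lt_succ]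
    push_cast
    ring

theorem tsum_tail_empirical {n : ℕ} (hn : 0 < n) (q : Fin n → ℕ) (j : ℕ) :
    ∑' m, empirical q (j + 1 + m) =
      ((Finset.univ.filter fun i => j < q i).card : ℝ) / n := by
  rw [Simplex.tsum_tail, sum_range_empirical hn]
  have h := Finset.card_filter_add_card_filter_not (s := (Finset.univ : Finset (Fin n)))
    (fun i => q i < j + 1)
  have h2 : (Finset.univ.filter fun i => ¬ q i < j + 1) = Finset.univ.filter fun i => j < q i := by
    ext i; simp
  rw [h2, Finset.card_univ, Fintype.card_fin] at h
  have h3 : ((Finset.univ.filter fun i => q i < j + 1).card : ℝ) +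
    (Finset.univ.filter fun i => j < q i).card = n := by exact_mod_cast h
  have hn' : (n : ℝ) ≠ 0 := by positivity
  rw [eq_div_iff hn', sub_mul, div_mul_cancel₀ _ hn']
  linarith

theorem routed_eq_sum {n L k : ℕ} (q : Fin n → ℕ) (j : ℕ) {A : Finset (Fin n)} (hA : A.card = L) :
    (routed k q j A : ℝ) = ∑ i₁ ∈ Finset.range k, ∑ i₂ ∈ Finset.Icc 1 (L - i₁),
      if (A.filter fun i => q i < j).card = i₁ ∧ (A.filter fun i => q i = j).card = i₂ then
        ((min i₂ (k - i₁) : ℕ) : ℝ) else 0 := by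
  unfold routed
  have hab := Finset.card_le_card (Finset.filter_subset (fun i => q i < j + 1) A)
  rw [card_filter_lt_succ, hA] at hab
  set a := (A.filter fun i => q i < j).card
  set b := (A.filter fun i => q i = j).card
  by_cases ha : a < k
  · rw [Finset.sum_eq_single a]
    · by_cases hb : b = 0
      · rw [hb, Finset.sum_eq_zero]
        · simp
        · intro i hi
          rw [if_neg]
          have := (Finset.mem_Icc.1 hi).1
          omega
      · rw [Finset.sum_eq_single b]
        · simp
        · intro i _ hi
          rw [if_neg (by tauto)]
        · intro hb'
          exact absurd (Finset.mem_Icc.2 ⟨by omega, by omega⟩) hb'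
    · intro i _ hi
      refine Finset.sum_eq_zero fun i' _ => ?_
      rw [if_neg (by tauto)]
    · intro h
      exact absurd (Finset.mem_range.2 ha) h
  -- At least `k` servers of `A` have shorter queues, so no job reaches level `j`; on the right no
  -- index `i₁ < k` matches.
  · rw [Finset.sum_eq_zero, Nat.sub_eq_zero_of_le (not_lt.1 ha)]
    · simp
    · intro i hi
      refine Finset.sum_eq_zero fun i' _ => ?_
      have := Finset.mem_range.1 hi
      rw [if_neg (by omega)]

theorem sum_routed {n L k : ℕ} (q : Fin n → ℕ) (j : ℕ) :
    ∑ A ∈ Finset.powersetCard L Finset.univ, (routed k q j A : ℝ) =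
      ∑ i₁ ∈ Finset.range k, ∑ i₂ ∈ Finset.Icc 1 (L - i₁), ((min i₂ (k - i₁) : ℕ) : ℝ) *
        ((Finset.powersetCard L (Finset.univ : Finset (Fin n))).filter fun A =>
          (A.filter fun i => q i < j).card = i₁ ∧ (A.filter fun i => q i = j).card = i₂).card := by
  rw [Finset.sum_congr rfl fun A hA => routed_eq_sum q j (Finset.mem_powersetCard.1 hA).2,
    Finset.sum_comm]
  refine Finset.sum_congr rfl fun i₁ _ => ?_
  rw [Finset.sum_comm]
  refine Finset.sum_congr rfl fun i₂ _ => ?_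
  rw [← Finset.sum_filter, Finset.sum_const, nsmul_eq_mul, mul_comm]

/-- The constant in the comparison of sampling without and with replacement. -/
def samplingConst (L k : ℕ) : ℝ :=
  ∑ i₁ ∈ Finset.range k, ∑ i₂ ∈ Finset.Icc 1 (L - i₁), ((min i₂ (k - i₁) : ℕ) : ℝ) *
    ((1 + 3 * L.factorial) * (L : ℝ) ^ 2)

theorem abs_meanRouted_sub_le {n L k : ℕ} (hkL : k ≤ L) (hn : L ≤ n) (hn0 : 0 < n)
    (q : Fin n → ℕ) (j : ℕ) :
    |meanRouted L k q j - L.factorial * zetaBar L k j (empirical q)| ≤ samplingConst L k / n := by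
  rw [zetaBar_eq_zetaPoly, sum_range_empirical hn0, tsum_tail_empirical hn0, empirical_eq_card hn0]
  unfold meanRouted zetaPoly samplingConst zetaCoeff
  rw [sum_routed, Finset.sum_div, Finset.sum_div, Finset.mul_sum, ← Finset.sum_sub_distrib]
  refine (Finset.abs_sum_le_sum_abs _ _).trans (Finset.sum_le_sum fun i₁ h₁ => ?_)
  rw [Finset.sum_div, Finset.sum_div, Finset.mul_sum, ← Finset.sum_sub_distrib]
  refine (Finset.abs_sum_le_sum_abs _ _).trans (Finset.sum_le_sum fun i₂ h₂ => ?_)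
  obtain ⟨i₃, hi₃⟩ : ∃ i₃, L = i₁ + i₂ + i₃ :=
    ⟨L - i₁ - i₂, by have := Finset.mem_range.1 h₁; have := Finset.mem_Icc.1 h₂; omega⟩
  have h3 : L - i₁ - i₂ = i₃ := by omega
  have hcount := card_powersetCard_filter q j i₁ i₂ i₃
  rw [← hi₃] at hcount
  have hle : ∀ p : Fin n → Prop, ∀ [DecidablePred p], (Finset.univ.filter p).card ≤ n := by
    intro p _
    simpa using Finset.card_filter_le Finset.univ p
  have hle2 := Finset.card_filter_le (Finset.powersetCard L (Finset.univ : Finset (Fin n))) fun A =>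
    (A.filter fun i => q i < j).card = i₁ ∧ (A.filter fun i => q i = j).card = i₂
  rw [hcount, Finset.card_powersetCard, Finset.card_univ, Fintype.card_fin] at hle2
  have key := abs_hypergeometric_sub_le (i₁ := i₁) (i₂ := i₂) (i₃ := i₃) (by omega) hn0
    (hle fun i => q i < j) (hle fun i => q i = j) (hle fun i => j < q i) (by rwa [← hi₃])
  rw [← hi₃] at key
  rw [hcount, h3]
  rw [mul_div_assoc, mul_div_assoc]
  refine le_trans (le_of_eq ?_) (mul_le_mul_of_nonneg_left key (Nat.cast_nonneg _))
  rw [← abs_of_nonneg (Nat.cast_nonneg (min i₂ (k - i₁)) : (0 : ℝ) ≤ _), ← abs_mul,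
    abs_of_nonneg (Nat.cast_nonneg (min i₂ (k - i₁)) : (0 : ℝ) ≤ _)]
  congr 1
  ring

theorem abs_generator_empirical_sub_le {n L c k : ℕ} (hkL : k ≤ L) (hc : 1 ≤ c) (hn : L ≤ n)
    (hn0 : 0 < n) {lam : ℝ} (hlam : 0 ≤ lam) (S : Storage n L c) (R : Routing n L k) (j : ℕ)
    (q : Fin n → ℕ) :
    |generator k lam S R (fun q => empirical q j) q - driftCoord L k lam (empirical q) j| ≤
      2 * lam * samplingConst L k / n := by
  rw [generator_empirical hc hn0]
  unfold driftCoord zetaBarDelta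
  have h1 := abs_meanRouted_sub_le hkL hn hn0 q j
  have h0 : 0 ≤ samplingConst L k / n := (abs_nonneg _).trans h1
  have h2 : |(if j = 0 then 0 else meanRouted L k q (j - 1)) -
      L.factorial * (if j = 0 then 0 else zetaBar L k (j - 1) (empirical q))| ≤
      samplingConst L k / n := by
    split_ifs
    · simpa using h0
    · exact abs_meanRouted_sub_le hkL hn hn0 q _
  generalize (if j = 0 then 0 else meanRouted L k q (j - 1)) = u at *
  generalize (if j = 0 then 0 else zetaBar L k (j - 1) (empirical q)) = v at *
  have e : ∀ x y c d : ℝ, lam * (u - x) + c + d - (lam * (L.factorial : ℝ) * (v - y) + c + d) =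
      lam * ((u - L.factorial * v) - (x - L.factorial * y)) := by
    intros; ring
  rw [e, abs_mul, abs_of_nonneg hlam]
  calc _ ≤ lam * (samplingConst L k / n + samplingConst L k / n) := by
        gcongr
        exact (abs_sub _ _).trans (add_le_add h2 h1)
    _ = _ := by ring

/-! ### The drift on the simplex -/

/-- `ζ̄(j, r)` for sequences `r` of total mass one, in terms of `r₀, …, r_j`. -/
def zetaTrunc (L k j : ℕ) (r : ℕ → ℝ) : ℝ :=
  zetaPoly L k (∑ m ∈ Finset.range j, r m) (r j) (1 - ∑ m ∈ Finset.range (j + 1), r m)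

/-- The drift for sequences `r` of total mass one, in terms of `r₀, …, r_{j+1}`. -/
def driftTrunc (L k : ℕ) (lam : ℝ) (r : ℕ → ℝ) (j : ℕ) : ℝ :=
  lam * (L.factorial : ℝ) * ((if j = 0 then 0 else zetaTrunc L k (j - 1) r) - zetaTrunc L k j r) +
    k * (r (j + 1) - r j) + if j = 0 then k * r 0 else 0

theorem Simplex.zetaBar_eq (s : Simplex) (L k j : ℕ) : zetaBar L k j s = zetaTrunc L k j s := by
  rw [zetaBar_eq_zetaPoly, s.tsum_tail, zetaTrunc]

theorem Simplex.driftCoord_eq (s : Simplex) (L k : ℕ) (lam : ℝ) (j : ℕ) :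
    driftCoord L k lam s j = driftTrunc L k lam s j := by
  simp only [driftCoord, driftTrunc, zetaBarDelta, s.zetaBar_eq]

theorem continuous_zetaTrunc (L k j : ℕ) : Continuous fun r : ℕ → ℝ => zetaTrunc L k j r := by
  unfold zetaTrunc zetaPoly
  fun_prop

theorem continuous_driftTrunc (L k : ℕ) (lam : ℝ) (j : ℕ) :
    Continuous fun r : ℕ → ℝ => driftTrunc L k lam r j := by
  have h := continuous_zetaTrunc L k
  unfold driftTrunc
  split_ifs <;> fun_prop

/-- The sum telescopes to the net flux into `{0, …, J}`: services at level `J + 1` bring mass in,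
arrivals at level `J` carry mass out. -/
theorem sum_range_driftTrunc (L k : ℕ) (lam : ℝ) (r : ℕ → ℝ) (J : ℕ) :
    ∑ j ∈ Finset.range (J + 1), driftTrunc L k lam r j =
      k * r (J + 1) - lam * (L.factorial : ℝ) * zetaTrunc L k J r := by
  induction J with
  | zero => simp [driftTrunc]; ring
  | succ J ih =>
    rw [Finset.sum_range_succ, ih]
    simp [driftTrunc]
    ring

theorem zetaTrunc_mem {r : ℕ → ℝ} (h0 : ∀ j, 0 ≤ r j)
    (h1 : ∀ J, ∑ j ∈ Finset.range J, r j ≤ 1) (L k j : ℕ) :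
    0 ≤ zetaTrunc L k j r ∧ zetaTrunc L k j r ≤ zetaMass L k * r j := by
  have hs : ∀ J, 0 ≤ ∑ j ∈ Finset.range J, r j := fun J => Finset.sum_nonneg fun j _ => h0 j
  have hj : r j ≤ 1 := by
    have := h1 (j + 1)
    rw [Finset.sum_range_succ] at this
    linarith [hs j]
  have h2 := h1 (j + 1)
  have h3 := hs (j + 1)
  exact ⟨zetaPoly_nonneg L k (hs j) (h0 j) (by linarith),
    zetaPoly_le L k ⟨hs j, h1 j⟩ ⟨h0 j, hj⟩ ⟨by linarith, by linarith⟩⟩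

theorem Simplex.sum_range_le_one (s : Simplex) (J : ℕ) : ∑ j ∈ Finset.range J, s j ≤ 1 :=
  sum_le_hasSum _ (fun j _ => s.nonneg j) s.hasSum

theorem Simplex.sum_range_nonneg (s : Simplex) (J : ℕ) : 0 ≤ ∑ j ∈ Finset.range J, s j :=
  Finset.sum_nonneg fun j _ => s.nonneg j

theorem Simplex.mem_unit (s : Simplex) (j : ℕ) : 0 ≤ s j ∧ s j ≤ 1 :=
  ⟨s.nonneg j, le_hasSum s.hasSum j fun i _ => s.nonneg i⟩

/-- A bound for the `ℓ₁` norm of the drift on the simplex. -/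
def driftBound (L k : ℕ) (lam : ℝ) : ℝ := 2 * (lam * L.factorial * zetaMass L k) + 3 * k

theorem driftBound_nonneg (L k : ℕ) {lam : ℝ} (hlam : 0 ≤ lam) : 0 ≤ driftBound L k lam := by
  have := zetaMass_nonneg L k
  unfold driftBound
  positivity

theorem Simplex.abs_driftCoord_le_coords (s : Simplex) (L k : ℕ) {lam : ℝ} (hlam : 0 ≤ lam) (j : ℕ) :
    |driftCoord L k lam s j| ≤ lam * L.factorial * zetaMass L k *
      ((if j = 0 then 0 else s (j - 1)) + s j) + k * (s (j + 1) + s j) +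
        if j = 0 then k * s 0 else 0 := by
  rw [s.driftCoord_eq]
  unfold driftTrunc
  have hz := zetaTrunc_mem s.nonneg s.sum_range_le_one L k
  have h1 : |(if j = 0 then 0 else zetaTrunc L k (j - 1) s) - zetaTrunc L k j s| ≤
      zetaMass L k * ((if j = 0 then 0 else s (j - 1)) + s j) := by
    have := hz j
    split_ifs
    · rw [abs_le]; constructor <;> linarith
    · have := hz (j - 1)
      rw [abs_le]; constructor <;> linarith
  have h2 : |(k : ℝ) * (s (j + 1) - s j)| ≤ k * (s (j + 1) + s j) := by
    rw [abs_mul, Nat.abs_cast]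
    gcongr
    rw [abs_le]; constructor <;> linarith [s.nonneg j, s.nonneg (j + 1)]
  have h3 : |if j = 0 then (k : ℝ) * s 0 else 0| = if j = 0 then (k : ℝ) * s 0 else 0 := by
    rw [abs_of_nonneg]
    have := s.nonneg 0
    split_ifs <;> positivity
  refine (abs_add_three _ _ _).trans ?_
  rw [h3]
  refine add_le_add (add_le_add ?_ h2) le_rfl
  rw [abs_mul, abs_of_nonneg (by positivity), mul_assoc (lam * (L.factorial : ℝ))]
  gcongr

theorem Simplex.sum_abs_driftCoord_le (s : Simplex) (L k : ℕ) {lam : ℝ} (hlam : 0 ≤ lam) (J : ℕ) :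
    ∑ j ∈ Finset.range J, |driftCoord L k lam s j| ≤ driftBound L k lam := by
  refine (Finset.sum_le_sum fun j _ => s.abs_driftCoord_le_coords L k hlam j).trans ?_
  rw [Finset.sum_add_distrib, Finset.sum_add_distrib, ← Finset.mul_sum, ← Finset.mul_sum,
    Finset.sum_add_distrib, Finset.sum_add_distrib]
  have h1 : ∑ j ∈ Finset.range J, (if j = 0 then 0 else s (j - 1)) ≤ 1 := by
    rcases J with _ | J
    · simp
    · rw [Finset.sum_range_succ']
      simpa using s.sum_range_le_one J
  have h2 : ∑ j ∈ Finset.range J, s (j + 1) ≤ 1 := by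
    have := s.sum_range_le_one (J + 1)
    rw [Finset.sum_range_succ'] at this
    linarith [s.nonneg 0]
  have h3 : ∑ j ∈ Finset.range J, (if j = 0 then (k : ℝ) * s 0 else 0) ≤ k := by
    have hk : (k : ℝ) * s 0 ≤ k := mul_le_of_le_one_right (Nat.cast_nonneg _) (s.mem_unit 0).2
    rcases J with _ | J
    · simp
    · rw [Finset.sum_range_succ']
      simpa using hk
  have h4 := s.sum_range_le_one J
  have hW := zetaMass_nonneg L k
  calc _ ≤ lam * L.factorial * zetaMass L k * (1 + 1) + k * (1 + 1) + k := by gcongr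
    _ = driftBound L k lam := by unfold driftBound; ring

theorem Simplex.abs_driftCoord_le (s : Simplex) (L k : ℕ) {lam : ℝ} (hlam : 0 ≤ lam) (j : ℕ) :
    |driftCoord L k lam s j| ≤ driftBound L k lam :=
  (Finset.single_le_sum (f := fun j => |driftCoord L k lam s j|) (fun _ _ => abs_nonneg _)
    (Finset.self_mem_range_succ j)).trans (s.sum_abs_driftCoord_le L k hlam (j + 1))

/-! ### The drift is Lipschitz for `d₀` on the simplex -/

theorem Simplex.dist_eq (s t : Simplex) : dist s t = ∑' j, |s j - t j| / 2 ^ j := rfl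

theorem Simplex.sum_range_le_dist (s t : Simplex) (J : ℕ) :
    ∑ j ∈ Finset.range J, |s j - t j| / 2 ^ j ≤ dist s t :=
  (summable_dist s t).sum_le_tsum _ fun j _ => by positivity

theorem Simplex.dist_le_of_sum_range_le {s t : Simplex} {a : ℝ}
    (h : ∀ J, ∑ j ∈ Finset.range J, |s j - t j| / 2 ^ j ≤ a) : dist s t ≤ a :=
  (summable_dist s t).tsum_le_of_sum_range_le h

theorem Simplex.abs_sub_le_dist (s t : Simplex) (j : ℕ) : |s j - t j| ≤ 2 ^ j * dist s t := by
  have h := (summable_dist s t).le_tsum j fun i _ => by positivity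
  rw [div_le_iff₀ (by positivity)] at h
  rw [mul_comm]
  exact h

theorem sum_div_two_pow_le {e : ℕ → ℝ} {a : ℝ} (ha : 0 ≤ a) (he : ∀ j, e j ≤ a) (J : ℕ) :
    ∑ j ∈ Finset.range J, e j / 2 ^ j ≤ 2 * a := by
  calc ∑ j ∈ Finset.range J, e j / 2 ^ j ≤ ∑ j ∈ Finset.range J, a * (1 / 2 : ℝ) ^ j := by
        refine Finset.sum_le_sum fun j _ => ?_
        rw [one_div, inv_pow, ← div_eq_mul_inv]
        gcongr
        exact he j
    _ = a * ∑ j ∈ Finset.range J, (1 / 2 : ℝ) ^ j := by rw [Finset.mul_sum]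
    _ ≤ a * ∑' j : ℕ, (1 / 2 : ℝ) ^ j :=
        mul_le_mul_of_nonneg_left
          (summable_geometric_two.sum_le_tsum _ fun j _ => by positivity) ha
    _ = 2 * a := by rw [tsum_geometric_two, mul_comm]

theorem Simplex.dist_le_of_abs_sub_le {s t : Simplex} {a : ℝ} (ha : 0 ≤ a)
    (h : ∀ j, |s j - t j| ≤ a) : dist s t ≤ 2 * a :=
  dist_le_of_sum_range_le fun J => sum_div_two_pow_le ha h J

theorem Simplex.abs_zetaTrunc_sub_le (s t : Simplex) {L k : ℕ} (hkL : k ≤ L) (j : ℕ) :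
    |zetaTrunc L k j s - zetaTrunc L k j t| ≤
      2 * (zetaMass L k * L) * ∑ m ∈ Finset.range (j + 1), |s m - t m| := by
  have hW := zetaMass_nonneg L k
  have tail : ∀ u : Simplex, 0 ≤ 1 - ∑ m ∈ Finset.range (j + 1), u m ∧
      1 - ∑ m ∈ Finset.range (j + 1), u m ≤ 1 := fun u =>
    ⟨by linarith [u.sum_range_le_one (j + 1)], by linarith [u.sum_range_nonneg (j + 1)]⟩
  have h := abs_zetaPoly_sub_le L k hkL ⟨s.sum_range_nonneg j, s.sum_range_le_one j⟩ (s.mem_unit j)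
    (tail s) ⟨t.sum_range_nonneg j, t.sum_range_le_one j⟩ (t.mem_unit j) (tail t)
  refine h.trans ?_
  have hs : ∀ J, |∑ m ∈ Finset.range J, s m - ∑ m ∈ Finset.range J, t m| ≤
      ∑ m ∈ Finset.range J, |s m - t m| := fun J => by
    rw [← Finset.sum_sub_distrib]
    exact Finset.abs_sum_le_sum_abs _ _
  have h1 := hs j
  have h2 := hs (j + 1)
  rw [sub_sub_sub_cancel_left, abs_sub_comm (∑ m ∈ Finset.range (j + 1), t m)]
  have h3 := Finset.sum_range_succ (fun m => |s m - t m|) j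
  calc _ ≤ zetaMass L k * (L * (2 * ∑ m ∈ Finset.range (j + 1), |s m - t m|)) := by
        gcongr
        linarith
    _ = _ := by ring

/-- After interchanging the sums, `δ m` carries the weights `2⁻ʲ` with `j ≥ m - 1`, in total `4 ·
2⁻ᵐ` for `m ≥ 1`. The corrections account for the cut-off at `J` and for `m = 0`. -/
theorem sum_div_two_pow_partial_sums (δ : ℕ → ℝ) (J : ℕ) :
    ∑ j ∈ Finset.range J, (∑ m ∈ Finset.range (j + 2), δ m) / 2 ^ j =
      4 * ∑ m ∈ Finset.range (J + 1), δ m / 2 ^ m -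
        2 * (∑ m ∈ Finset.range (J + 1), δ m) / 2 ^ J - 2 * δ 0 := by
  induction J with
  | zero => simp; ring
  | succ J ih =>
    rw [Finset.sum_range_succ, ih, Finset.sum_range_succ (fun m => δ m / 2 ^ m) (J + 1),
      Finset.sum_range_succ δ (J + 1), pow_succ]
    field_simp
    ring

/-- A Lipschitz constant of the drift on the simplex, for the metric `d₀`. -/
def driftLip (L k : ℕ) (lam : ℝ) : ℝ := 4 * (4 * (lam * L.factorial * (zetaMass L k * L)) + 2 * k)

theorem driftLip_nonneg (L k : ℕ) {lam : ℝ} (hlam : 0 ≤ lam) : 0 ≤ driftLip L k lam := by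
  have := zetaMass_nonneg L k
  unfold driftLip
  positivity

/-- Coordinate `j` of the drift looks only one coordinate further, so the geometric weights of `d₀`
lose just a constant factor. The `4` divided out here is the one from the interchange of sums. -/
theorem Simplex.abs_driftCoord_sub_le (s t : Simplex) {L k : ℕ} (hkL : k ≤ L) {lam : ℝ}
    (hlam : 0 ≤ lam) (j : ℕ) : |driftCoord L k lam s j - driftCoord L k lam t j| ≤
      driftLip L k lam / 4 * ∑ m ∈ Finset.range (j + 2), |s m - t m| := by
  rw [s.driftCoord_eq, t.driftCoord_eq]
  have hW := zetaMass_nonneg L k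
  set σ := ∑ m ∈ Finset.range (j + 2), |s m - t m| with hσ
  have hmono : ∀ i ≤ j + 2, ∑ m ∈ Finset.range i, |s m - t m| ≤ σ := fun i hi =>
    Finset.sum_le_sum_of_subset_of_nonneg (Finset.range_mono hi) fun _ _ _ => abs_nonneg _
  have hσ0 : 0 ≤ σ := Finset.sum_nonneg fun _ _ => abs_nonneg _
  have hz : ∀ i ≤ j, |zetaTrunc L k i s - zetaTrunc L k i t| ≤
      2 * (zetaMass L k * L) * σ := fun i hi =>
    (abs_zetaTrunc_sub_le s t hkL i).trans
      (mul_le_mul_of_nonneg_left (hmono _ (by omega)) (by positivity))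
  have h1 := hz j le_rfl
  have h2 : |(if j = 0 then 0 else zetaTrunc L k (j - 1) s) -
      (if j = 0 then 0 else zetaTrunc L k (j - 1) t)| ≤ 2 * (zetaMass L k * L) * σ := by
    split_ifs
    · simpa using (abs_nonneg _).trans h1
    · exact hz _ (by omega)
  have h3 : |s (j + 1) - t (j + 1)| + |s j - t j| ≤ σ := by
    rw [hσ, Finset.sum_range_succ, Finset.sum_range_succ]
    linarith [Finset.sum_nonneg (s := Finset.range j) fun m _ => abs_nonneg (s m - t m)]
  have h4 : |(if j = 0 then (k : ℝ) * s 0 else 0) - (if j = 0 then (k : ℝ) * t 0 else 0)| ≤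
      k * σ := by
    split_ifs
    · rw [← mul_sub, abs_mul, Nat.abs_cast]
      gcongr
      refine le_trans ?_ (hmono 1 (by omega))
      simp
    · simpa using by positivity
  unfold driftTrunc driftLip
  generalize (if j = 0 then 0 else zetaTrunc L k (j - 1) s) = u at *
  generalize (if j = 0 then 0 else zetaTrunc L k (j - 1) t) = v at *
  generalize (if j = 0 then (k : ℝ) * s 0 else 0) = w at *
  generalize (if j = 0 then (k : ℝ) * t 0 else 0) = w' at *
  have e : lam * (L.factorial : ℝ) * (u - zetaTrunc L k j s) + k * (s (j + 1) - s j) + w -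
      (lam * (L.factorial : ℝ) * (v - zetaTrunc L k j t) + k * (t (j + 1) - t j) + w') =
      lam * (L.factorial : ℝ) * ((u - v) - (zetaTrunc L k j s - zetaTrunc L k j t)) +
      k * ((s (j + 1) - t (j + 1)) - (s j - t j)) + (w - w') := by ring
  rw [e]
  refine (abs_add_three _ _ _).trans ?_
  rw [abs_mul, abs_of_nonneg (by positivity : 0 ≤ lam * (L.factorial : ℝ)), abs_mul, Nat.abs_cast]
  calc _ ≤ lam * (L.factorial : ℝ) * (2 * (zetaMass L k * L) * σ + 2 * (zetaMass L k * L) * σ) +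
        k * σ + k * σ := by
        gcongr
        · exact (abs_sub _ _).trans (add_le_add h2 h1)
        · exact (abs_sub _ _).trans h3
    _ = _ := by ring

theorem Simplex.sum_abs_driftCoord_sub_le (s t : Simplex) {L k : ℕ} (hkL : k ≤ L) {lam : ℝ}
    (hlam : 0 ≤ lam) (J : ℕ) :
    ∑ j ∈ Finset.range J, |driftCoord L k lam s j - driftCoord L k lam t j| / 2 ^ j ≤
      driftLip L k lam * dist s t := by
  have hK := driftLip_nonneg L k hlam
  calc _ ≤ ∑ j ∈ Finset.range J,
        driftLip L k lam / 4 * ((∑ m ∈ Finset.range (j + 2), |s m - t m|) / 2 ^ j) := by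
        refine Finset.sum_le_sum fun j _ => ?_
        rw [← mul_div_assoc]
        gcongr
        exact s.abs_driftCoord_sub_le t hkL hlam j
    _ ≤ driftLip L k lam / 4 * (4 * ∑ m ∈ Finset.range (J + 1), |s m - t m| / 2 ^ m) := by
        rw [← Finset.mul_sum, sum_div_two_pow_partial_sums fun m => |s m - t m|]
        gcongr
        have : 0 ≤ 2 * (∑ m ∈ Finset.range (J + 1), |s m - t m|) / 2 ^ J :=
          div_nonneg (mul_nonneg (by norm_num) (Finset.sum_nonneg fun _ _ => abs_nonneg _))
            (by positivity)
        linarith [abs_nonneg (s 0 - t 0)]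
    _ ≤ driftLip L k lam / 4 * (4 * dist s t) := by
        gcongr
        exact s.sum_range_le_dist t _
    _ = _ := by ring

/-! ### Approximate solutions -/

/-- `x` solves `ẋ = F(x)`, `x(0) = x₀` on `[0,T]` up to an error `ε` in the metric `d₀`. -/
structure IsApproxSolution (L k : ℕ) (lam T : ℝ) (x₀ : Simplex) (x : ℝ → Simplex) (ε : ℝ) :
    Prop where
  measurable : Measurable fun s => (x s : ℕ → ℝ)
  defect : ∀ t ∈ Set.Icc 0 T, ∀ J, ∑ j ∈ Finset.range J,
    |x t j - x₀ j - ∫ s in (0 : ℝ)..t, driftCoord L k lam (x s) j| / 2 ^ j ≤ ε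

theorem measurable_driftCoord {α : Type*} [MeasurableSpace α] (L k : ℕ) (lam : ℝ)
    {x : α → Simplex} (hx : Measurable fun s => (x s : ℕ → ℝ)) (j : ℕ) :
    Measurable fun s => driftCoord L k lam (x s) j := by
  simp_rw [Simplex.driftCoord_eq]
  exact (continuous_driftTrunc L k lam j).measurable.comp hx

theorem measurable_dist_simplex {α : Type*} [MeasurableSpace α] {x y : α → Simplex}
    (hx : Measurable fun s => (x s : ℕ → ℝ)) (hy : Measurable fun s => (y s : ℕ → ℝ)) :
    Measurable fun s => dist (x s) (y s) := by
  refine measurable_of_tendsto_metrizable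
    (f := fun J s => ∑ j ∈ Finset.range J, |x s j - y s j| / 2 ^ j) (fun J => ?_) ?_
  · refine Finset.measurable_fun_sum _ fun j _ => ?_
    exact (((measurable_pi_apply j).comp hx).sub ((measurable_pi_apply j).comp hy)).abs.div_const _
  · rw [tendsto_pi_nhds]
    exact fun s => (Simplex.summable_dist (x s) (y s)).hasSum.tendsto_sum_nat

theorem Simplex.dist_le_two (s t : Simplex) : dist s t ≤ 2 := by
  have := dist_le_of_abs_sub_le (s := s) (t := t) zero_le_one fun j => by
    have h1 := s.mem_unit j
    have h2 := t.mem_unit j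
    rw [abs_le]
    constructor <;> linarith
  simpa using this

/-- Gronwall's inequality in integral form, for bounded measurable functions. -/
theorem le_exp_of_le_integral {D : ℝ → ℝ} (hD : Measurable D) {B a K β T : ℝ} (ha : 0 ≤ a)
    (hβ : 0 < β) (hKβ : 2 * K ≤ β) (h0 : ∀ t, 0 ≤ D t) (hB : ∀ t, D t ≤ B)
    (h : ∀ t ∈ Set.Icc 0 T, D t ≤ a + K * ∫ s in (0 : ℝ)..t, D s) :
    ∀ t ∈ Set.Icc 0 T, D t ≤ 2 * a * Real.exp (β * t) := by
  -- `D` need not be continuous, so a weighted supremum replaces a differential inequality. With `m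
  -- = sup e^{-βt} D(t)` the hypothesis and `2 K ≤ β` give `m ≤ a + m / 2`, hence `m ≤ 2 a`.
  set E : ℝ → ℝ := fun t => Real.exp (-(β * t)) * D t with hE
  have hDE : ∀ t, D t = E t * Real.exp (β * t) := fun t => by
    rw [hE]
    simp only
    rw [mul_right_comm, ← Real.exp_add]
    simp
  have hbdd : BddAbove (E '' Set.Icc 0 T) := by
    refine ⟨B, ?_⟩
    rintro _ ⟨t, ht, rfl⟩
    refine (mul_le_of_le_one_left (h0 t) ?_).trans (hB t)
    rw [Real.exp_le_one_iff]
    have := mul_nonneg hβ.le ht.1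
    linarith
  set m := sSup (E '' Set.Icc 0 T) with hm
  have hEm : ∀ t ∈ Set.Icc 0 T, E t ≤ m := fun t ht => le_csSup hbdd ⟨t, ht, rfl⟩
  have hstep : ∀ t ∈ Set.Icc 0 T, E t ≤ a + m / 2 := by
    intro t ht
    have hm0 : 0 ≤ m := (mul_nonneg (Real.exp_pos _).le (h0 t)).trans (hEm t ht)
    have hI : ∫ s in (0 : ℝ)..t, D s ≤ m * (Real.exp (β * t) / β) := by
      calc ∫ s in (0 : ℝ)..t, D s ≤ ∫ s in (0 : ℝ)..t, m * Real.exp (β * s) := by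
            refine intervalIntegral.integral_mono_on ht.1
              (intervalIntegrable_of_abs_le hD (C := B) (fun s => ?_) _ _)
              (Continuous.intervalIntegrable (by fun_prop) _ _) fun s hs => ?_
            · rw [abs_of_nonneg (h0 s)]; exact hB s
            · rw [hDE s]
              exact mul_le_mul_of_nonneg_right (hEm s ⟨hs.1, hs.2.trans ht.2⟩) (Real.exp_pos _).le
        _ = m * ((Real.exp (β * t) - 1) / β) := by
            rw [intervalIntegral.integral_const_mul,
              intervalIntegral.integral_comp_mul_left (fun s => Real.exp s) hβ.ne']
            simp [integral_exp, div_eq_inv_mul]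
        _ ≤ m * (Real.exp (β * t) / β) := by gcongr; linarith
    have h1 := h t ht
    have h2 : K * ∫ s in (0 : ℝ)..t, D s ≤ m / 2 * Real.exp (β * t) := by
      calc K * ∫ s in (0 : ℝ)..t, D s ≤ β / 2 * (m * (Real.exp (β * t) / β)) := by
            refine mul_le_mul (by linarith) hI
              (intervalIntegral.integral_nonneg ht.1 fun s _ => h0 s) (by positivity)
        _ = _ := by field_simp
    have h3 : 1 ≤ Real.exp (β * t) := Real.one_le_exp (mul_nonneg hβ.le ht.1)
    have h4 : E t * Real.exp (β * t) ≤ (a + m / 2) * Real.exp (β * t) := by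
      rw [← hDE]
      nlinarith
    exact le_of_mul_le_mul_right h4 (Real.exp_pos _)
  intro t ht
  have hm2 : m ≤ a + m / 2 := by
    refine csSup_le ⟨E t, t, ht, rfl⟩ ?_
    rintro _ ⟨s, hs, rfl⟩
    exact hstep s hs
  rw [hDE]
  refine mul_le_mul_of_nonneg_right ((hEm t ht).trans ?_) (Real.exp_pos _).le
  linarith

/-- The constant in the comparison of approximate solutions on `[0,T]`. -/
def growthConst (L k : ℕ) (lam T : ℝ) : ℝ := 2 * Real.exp ((2 * driftLip L k lam + 1) * T)

theorem growthConst_pos (L k : ℕ) (lam T : ℝ) : 0 < growthConst L k lam T := by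
  unfold growthConst
  positivity

/-- Subtracting the two integral equations leaves both defects, the initial distance and the
integral of the drift difference, which is Lipschitz in `d₀`; then Gronwall. The paths need only be
measurable, so jumps are allowed. -/
theorem IsApproxSolution.dist_le {L k : ℕ} (hkL : k ≤ L) {lam T : ℝ} (hlam : 0 ≤ lam)
    {x₀ y₀ : Simplex} {x y : ℝ → Simplex} {ε ε' : ℝ} (hx : IsApproxSolution L k lam T x₀ x ε)
    (hy : IsApproxSolution L k lam T y₀ y ε') {t : ℝ} (ht : t ∈ Set.Icc 0 T) :
    dist (x t) (y t) ≤ growthConst L k lam T * (ε + ε' + dist x₀ y₀) := by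
  have hK := driftLip_nonneg L k hlam
  have hm := measurable_dist_simplex hx.measurable hy.measurable
  have hdx := fun j => measurable_driftCoord L k lam hx.measurable j
  have hdy := fun j => measurable_driftCoord L k lam hy.measurable j
  have hix := fun j => intervalIntegrable_of_abs_le (hdx j)
    (fun s => (x s).abs_driftCoord_le L k hlam j)
  have hiy := fun j => intervalIntegrable_of_abs_le (hdy j)
    (fun s => (y s).abs_driftCoord_le L k hlam j)
  have hiD := intervalIntegrable_of_abs_le hm (C := 2) fun s => by
    rw [abs_of_nonneg dist_nonneg]; exact Simplex.dist_le_two _ _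
  have hε : 0 ≤ ε := by simpa using hx.defect t ht 0
  have hε' : 0 ≤ ε' := by simpa using hy.defect t ht 0
  have ha : 0 ≤ ε + ε' + dist x₀ y₀ := by positivity
  have key : ∀ t ∈ Set.Icc 0 T, dist (x t) (y t) ≤ (ε + ε' + dist x₀ y₀) +
      driftLip L k lam * ∫ s in (0 : ℝ)..t, dist (x s) (y s) := by
    intro t ht
    refine Simplex.dist_le_of_sum_range_le fun J => ?_
    have hterm : ∀ j, |x t j - y t j| / 2 ^ j ≤
        |x t j - x₀ j - ∫ s in (0 : ℝ)..t, driftCoord L k lam (x s) j| / 2 ^ j +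
        |y t j - y₀ j - ∫ s in (0 : ℝ)..t, driftCoord L k lam (y s) j| / 2 ^ j +
        |x₀ j - y₀ j| / 2 ^ j +
        ∫ s in (0 : ℝ)..t,
          |driftCoord L k lam (x s) j - driftCoord L k lam (y s) j| / 2 ^ j := by
      intro j
      rw [intervalIntegral.integral_div, ← add_div, ← add_div, ← add_div]
      gcongr
      have h1 : |(∫ s in (0 : ℝ)..t, driftCoord L k lam (x s) j) -
          ∫ s in (0 : ℝ)..t, driftCoord L k lam (y s) j| ≤
          ∫ s in (0 : ℝ)..t, |driftCoord L k lam (x s) j - driftCoord L k lam (y s) j| := by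
        rw [← intervalIntegral.integral_sub (hix j _ _) (hiy j _ _)]
        exact intervalIntegral.abs_integral_le_integral_abs ht.1
      set X := ∫ s in (0 : ℝ)..t, driftCoord L k lam (x s) j
      set Y := ∫ s in (0 : ℝ)..t, driftCoord L k lam (y s) j
      have e : x t j - y t j =
          (x t j - x₀ j - X) - (y t j - y₀ j - Y) + (x₀ j - y₀ j) + (X - Y) := by
        ring
      rw [e]
      refine (abs_add_le _ _).trans (add_le_add ((abs_add_le _ _).trans
        (add_le_add (abs_sub _ _) le_rfl)) h1)
    refine (Finset.sum_le_sum fun j _ => hterm j).trans ?_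
    rw [Finset.sum_add_distrib, Finset.sum_add_distrib, Finset.sum_add_distrib]
    refine add_le_add (add_le_add (add_le_add (hx.defect t ht J) (hy.defect t ht J))
      (x₀.sum_range_le_dist y₀ J)) ?_
    have hij : ∀ j, IntervalIntegrable
        (fun s => |driftCoord L k lam (x s) j - driftCoord L k lam (y s) j| / 2 ^ j)
        volume 0 t := fun j => (((hix j _ _).sub (hiy j _ _)).abs).div_const _
    rw [← intervalIntegral.integral_finsetSum fun j _ => hij j,
      ← intervalIntegral.integral_const_mul]
    refine intervalIntegral.integral_mono ht.1 ?_ ((hiD 0 t).const_mul _)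
      fun s => (x s).sum_abs_driftCoord_sub_le (y s) hkL hlam J
    have := IntervalIntegrable.sum (Finset.range J) fun j _ => hij j
    simpa [Finset.sum_fn] using this
  -- The summand `1` makes the rate positive even if the Lipschitz constant is zero.
  have := le_exp_of_le_integral hm ha (β := 2 * driftLip L k lam + 1) (by positivity)
    (by linarith) (fun t => dist_nonneg) (fun t => Simplex.dist_le_two _ _) key t ht
  refine this.trans ?_
  unfold growthConst
  have hexp : Real.exp ((2 * driftLip L k lam + 1) * t) ≤
      Real.exp ((2 * driftLip L k lam + 1) * T) := by
    gcongr
    exact ht.2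
  nlinarith [mul_le_mul_of_nonneg_left hexp ha]

theorem IsApproxSolution.apply_eq {L k : ℕ} {lam T : ℝ} {x₀ : Simplex} {x : ℝ → Simplex}
    (hx : IsApproxSolution L k lam T x₀ x 0) {t : ℝ} (ht : t ∈ Set.Icc 0 T) (j : ℕ) :
    x t j = x₀ j + ∫ s in (0 : ℝ)..t, driftCoord L k lam (x s) j := by
  have h1 := hx.defect t ht (j + 1)
  have h2 := (Finset.single_le_sum (f := fun j =>
    |x t j - x₀ j - ∫ s in (0 : ℝ)..t, driftCoord L k lam (x s) j| / 2 ^ j)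
    (fun _ _ => by positivity) (Finset.self_mem_range_succ j)).trans h1
  have h3 : |x t j - x₀ j - ∫ s in (0 : ℝ)..t, driftCoord L k lam (x s) j| ≤ 0 := by
    rwa [div_le_iff₀ (by positivity), zero_mul] at h2
  have h4 := abs_nonpos_iff.1 h3
  linarith

theorem IsApproxSolution.dist_apply_le {L k : ℕ} {lam T : ℝ} (hlam : 0 ≤ lam) {x₀ : Simplex}
    {x : ℝ → Simplex} (hx : IsApproxSolution L k lam T x₀ x 0) {s t : ℝ} (hs : s ∈ Set.Icc 0 T)
    (ht : t ∈ Set.Icc 0 T) : dist (x s) (x t) ≤ 2 * driftBound L k lam * dist s t := by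
  have hB := driftBound_nonneg L k hlam
  rw [mul_assoc]
  refine Simplex.dist_le_of_abs_sub_le (by positivity) fun j => ?_
  have hi := intervalIntegrable_of_abs_le (measurable_driftCoord L k lam hx.measurable j)
    (fun s => (x s).abs_driftCoord_le L k hlam j)
  rw [hx.apply_eq hs, hx.apply_eq ht, add_sub_add_left_eq_sub,
    intervalIntegral.integral_interval_sub_left (hi _ _) (hi _ _), Real.dist_eq]
  exact intervalIntegral.norm_integral_le_of_norm_le_const
    (f := fun s => driftCoord L k lam (x s) j) fun s _ => (x s).abs_driftCoord_le L k hlam j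

/-! ### Limits of approximate solutions -/

theorem tendsto_apply_of_tendsto {ι : Type*} {l : Filter ι} {x : ι → Simplex} {s : Simplex}
    (h : Tendsto x l (𝓝 s)) (j : ℕ) : Tendsto (fun n => x n j) l (𝓝 (s j)) := by
  rw [tendsto_iff_dist_tendsto_zero] at h ⊢
  refine squeeze_zero (fun _ => dist_nonneg) (fun n => (x n).abs_sub_le_dist s j) ?_
  simpa using h.const_mul (2 ^ j)

/-- Approximate solutions with errors tending to zero converge to a solution. -/
theorem exists_solution_of_approx {L k : ℕ} (hkL : k ≤ L) {lam T : ℝ} (hlam : 0 ≤ lam)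
    (hT : 0 ≤ T) {π₀ : Simplex} {x₀ : ℕ → Simplex} {x : ℕ → ℝ → Simplex} {ε : ℕ → ℝ}
    (hx : ∀ n, IsApproxSolution L k lam T (x₀ n) (x n) (ε n)) (hε : Tendsto ε atTop (𝓝 0))
    (hx₀ : Tendsto x₀ atTop (𝓝 π₀)) :
    ∃ y : ℝ → Simplex, IsApproxSolution L k lam T π₀ y 0 ∧ ∀ s, y (Set.projIcc 0 T hT s) = y s := by
  have hG := (growthConst_pos L k lam T).le
  set p : ℝ → ℝ := fun s => (Set.projIcc 0 T hT s : ℝ) with hp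
  have hpmem : ∀ s, p s ∈ Set.Icc 0 T := fun s => (Set.projIcc 0 T hT s).2
  have hpp : ∀ s ∈ Set.Icc 0 T, p s = s := fun s hs => by
    simp only [hp, Set.projIcc_of_mem hT hs]
  have hpm : Measurable p := (continuous_subtype_val.comp continuous_projIcc).measurable
  -- the coordinates converge
  have hcauchy : ∀ s j, ∃ l, Tendsto (fun n => x n (p s) j) atTop (𝓝 l) := by
    intro s j
    refine cauchySeq_tendsto_of_complete (cauchySeq_iff_tendsto_dist_atTop_0.2 ?_)
    have hb : Tendsto (fun n : ℕ × ℕ => 2 ^ j * (growthConst L k lam T *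
        (ε n.1 + ε n.2 + (dist (x₀ n.1) π₀ + dist (x₀ n.2) π₀)))) atTop (𝓝 0) := by
      have h1 : Tendsto (Prod.fst : ℕ × ℕ → ℕ) atTop atTop := by
        rw [← prod_atTop_atTop_eq]; exact tendsto_fst
      have h2 : Tendsto (Prod.snd : ℕ × ℕ → ℕ) atTop atTop := by
        rw [← prod_atTop_atTop_eq]; exact tendsto_snd
      have h3 := tendsto_iff_dist_tendsto_zero.1 hx₀
      simpa using ((((hε.comp h1).add (hε.comp h2)).add
        ((h3.comp h1).add (h3.comp h2))).const_mul (growthConst L k lam T)).const_mul (2 ^ j)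
    refine squeeze_zero (fun _ => dist_nonneg) (fun n => ?_) hb
    refine ((x n.1 (p s)).abs_sub_le_dist (x n.2 (p s)) j).trans ?_
    refine mul_le_mul_of_nonneg_left ?_ (by positivity)
    refine ((hx n.1).dist_le hkL hlam (hx n.2) (hpmem s)).trans ?_
    gcongr
    exact dist_triangle_right _ _ _
  choose z hz using hcauchy
  have hzvec : ∀ s, Tendsto (fun n => (x n (p s) : ℕ → ℝ)) atTop (𝓝 (z s)) := fun s =>
    tendsto_pi_nhds.2 (hz s)
  have hzm : Measurable z :=
    measurable_of_tendsto_metrizable (fun n => (hx n).measurable.comp hpm)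
      (tendsto_pi_nhds.2 hzvec)
  have hzp : ∀ s, z (p s) = z s := fun s => by
    refine tendsto_nhds_unique (hzvec (p s)) ?_
    simp_rw [hpp _ (hpmem s)]
    exact hzvec s
  have hz0 : ∀ s j, 0 ≤ z s j := fun s j => ge_of_tendsto' (hz s j) fun n => (x n _).nonneg j
  have hz1 : ∀ s J, ∑ j ∈ Finset.range J, z s j ≤ 1 := fun s J =>
    le_of_tendsto' (tendsto_finsetSum _ fun j _ => hz s j) fun n => (x n _).sum_range_le_one J
  have hzle : ∀ s j, z s j ≤ 1 := fun s j =>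
    le_of_tendsto' (hz s j) fun n => ((x n _).mem_unit j).2
  have hzj : ∀ j, Measurable fun s => z s j := fun j => (measurable_pi_apply j).comp hzm
  -- the limit solves the equation in each coordinate
  have hdt : ∀ s j, Tendsto (fun n => driftCoord L k lam (x n (p s)) j) atTop
      (𝓝 (driftTrunc L k lam (z s) j)) := fun s j => by
    simp_rw [Simplex.driftCoord_eq]
    exact ((continuous_driftTrunc L k lam j).tendsto (z s)).comp (hzvec s)
  have hdm : ∀ j, Measurable fun s => driftTrunc L k lam (z s) j := fun j =>
    (continuous_driftTrunc L k lam j).measurable.comp hzm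
  -- The limit `z s` is not yet known to have mass one, so the drift appears in its truncated form
  -- and the bound is inherited from the approximations.
  have hdb : ∀ j s, |driftTrunc L k lam (z s) j| ≤ driftBound L k lam := fun j s =>
    le_of_tendsto' (hdt s j).abs fun n => (x n _).abs_driftCoord_le L k hlam j
  have hdi := fun j => intervalIntegrable_of_abs_le (hdm j) (hdb j)
  have heq : ∀ t ∈ Set.Icc 0 T, ∀ j,
      z t j = π₀ j + ∫ s in (0 : ℝ)..t, driftTrunc L k lam (z s) j := by
    intro t ht j
    have hI : Tendsto (fun n => ∫ s in (0 : ℝ)..t, driftCoord L k lam (x n s) j) atTop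
        (𝓝 (∫ s in (0 : ℝ)..t, driftTrunc L k lam (z s) j)) := by
      refine intervalIntegral.tendsto_integral_filter_of_dominated_convergence
        (fun _ => driftBound L k lam)
        (Eventually.of_forall fun n =>
          (measurable_driftCoord L k lam (hx n).measurable j).aestronglyMeasurable)
        (Eventually.of_forall fun n => ae_of_all _ fun s _ =>
          (x n s).abs_driftCoord_le L k hlam j) intervalIntegrable_const
        (ae_of_all _ fun s hs => ?_)
      rw [Set.uIoc_of_le ht.1] at hs
      have := hdt s j
      rwa [hpp s ⟨hs.1.le, hs.2.trans ht.2⟩] at this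
    have h1 := ((hz t j).sub (tendsto_apply_of_tendsto hx₀ j)).sub hI
    rw [hpp t ht] at h1
    have h2 : Tendsto (fun n => x n t j - x₀ n j - ∫ s in (0 : ℝ)..t, driftCoord L k lam (x n s) j)
        atTop (𝓝 0) := by
      refine squeeze_zero_norm (a := fun n => ε n * 2 ^ j) (fun n => ?_)
        (by simpa using hε.mul_const (2 ^ j))
      have h3 := (Finset.single_le_sum (f := fun j =>
        |x n t j - x₀ n j - ∫ s in (0 : ℝ)..t, driftCoord L k lam (x n s) j| / 2 ^ j)
        (fun _ _ => by positivity) (Finset.self_mem_range_succ j)).trans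
        ((hx n).defect t ht (j + 1))
      rwa [div_le_iff₀ (by positivity)] at h3
    have := tendsto_nhds_unique h1 h2
    linarith
  -- no mass is lost
  have hsum : ∀ s, Summable (z s) := fun s => summable_of_sum_range_le (hz0 s) (hz1 s)
  have hmass : ∀ t ∈ Set.Icc 0 T, HasSum (z t) 1 := by
    intro t ht
    rw [hasSum_iff_tendsto_nat_of_nonneg (hz0 t), ← tendsto_add_atTop_iff_nat 1]
    -- Mass leaves `{0, …, J}` only through arrivals at level `J`, at a rate linear in `z s J`; the
    -- inflow from level `J + 1` is nonnegative and is dropped.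
    have hlow : ∀ J, ∑ j ∈ Finset.range (J + 1), π₀ j -
        lam * L.factorial * zetaMass L k * ∫ s in (0 : ℝ)..t, z s J ≤
        ∑ j ∈ Finset.range (J + 1), z t j := by
      intro J
      rw [Finset.sum_congr rfl fun j _ => heq t ht j, Finset.sum_add_distrib,
        ← intervalIntegral.integral_finsetSum fun j _ => hdi j _ _]
      simp_rw [sum_range_driftTrunc]
      rw [sub_eq_add_neg, ← intervalIntegral.integral_const_mul, ← intervalIntegral.integral_neg]
      refine add_le_add le_rfl (intervalIntegral.integral_mono ht.1 ?_ ?_ fun s => ?_)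
      · exact ((intervalIntegrable_of_abs_le (hzj J) (C := 1) (fun s => by
          rw [abs_of_nonneg (hz0 s J)]; exact hzle s J) _ _).const_mul _).neg
      · have := IntervalIntegrable.sum (Finset.range (J + 1)) fun j _ => hdi j 0 t
        simp_rw [← sum_range_driftTrunc]
        simpa [Finset.sum_fn] using this
      · have h1 := (zetaTrunc_mem (hz0 s) (hz1 s) L k J).2
        have h2 := mul_le_mul_of_nonneg_left h1 (by positivity : 0 ≤ lam * (L.factorial : ℝ))
        have h3 : 0 ≤ (k : ℝ) * z s (J + 1) := mul_nonneg (Nat.cast_nonneg _) (hz0 s _)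
        simp only
        linarith
    -- Each `z s` is summable, so its coordinates tend to zero and dominated convergence applies.
    have hI : Tendsto (fun J => ∫ s in (0 : ℝ)..t, z s J) atTop (𝓝 0) := by
      have : Tendsto (fun J => ∫ s in (0 : ℝ)..t, z s J) atTop
          (𝓝 (∫ s in (0 : ℝ)..t, (0 : ℝ))) := by
        refine intervalIntegral.tendsto_integral_filter_of_dominated_convergence (fun _ => (1 : ℝ))
          (Eventually.of_forall fun J => (hzj J).aestronglyMeasurable)
          (Eventually.of_forall fun J => ae_of_all _ fun s _ => ?_) intervalIntegrable_const
          (ae_of_all _ fun s _ => (hsum s).tendsto_atTop_zero)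
        rw [Real.norm_eq_abs, abs_of_nonneg (hz0 s J)]
        exact hzle s J
      simpa using this
    have hlim : Tendsto (fun J => ∑ j ∈ Finset.range (J + 1), π₀ j -
        lam * L.factorial * zetaMass L k * ∫ s in (0 : ℝ)..t, z s J) atTop (𝓝 1) := by
      have h1 := (tendsto_add_atTop_iff_nat 1).2 π₀.hasSum.tendsto_sum_nat
      simpa using h1.sub (hI.const_mul (lam * L.factorial * zetaMass L k))
    exact tendsto_of_tendsto_of_tendsto_of_le_of_le hlim tendsto_const_nhds hlow
      fun J => hz1 t (J + 1)
  have hmass' : ∀ s, HasSum (z s) 1 := fun s => hzp s ▸ hmass (p s) (hpmem s)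
  let y : ℝ → Simplex := fun s => ⟨z s, hz0 s, hmass' s⟩
  have hy : ∀ t ∈ Set.Icc 0 T, ∀ j,
      y t j = π₀ j + ∫ s in (0 : ℝ)..t, driftCoord L k lam (y s) j := by
    intro t ht j
    simp_rw [Simplex.driftCoord_eq]
    exact heq t ht j
  refine ⟨y, ⟨hzm, fun t ht J => ?_⟩, fun s => Subtype.ext (hzp s)⟩
  refine le_of_eq (Finset.sum_eq_zero fun j _ => ?_)
  rw [hy t ht j]
  simp

/-! ### Solutions in `ℓ₁` -/

theorem norm_drift_le (L k : ℕ) {lam : ℝ} (hlam : 0 ≤ lam) (s : Simplex) :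
    ‖drift L k lam s.toL1‖ ≤ driftBound L k lam := by
  refine lp.norm_le_of_tsum_le (by norm_num) (driftBound_nonneg L k hlam) ?_
  simp only [ENNReal.toReal_one, Real.rpow_one, Real.norm_eq_abs]
  refine Real.tsum_le_of_sum_range_le (fun _ => abs_nonneg _) fun J => ?_
  exact s.sum_abs_driftCoord_le L k hlam J

/-- In `ℓ₁` the drift is the limit of its finite sections, whose coordinates are measurable. -/
theorem stronglyMeasurable_drift {α : Type*} [MeasurableSpace α] (L k : ℕ) (lam : ℝ)
    {x : α → Simplex} (hx : Measurable fun s => (x s : ℕ → ℝ)) :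
    StronglyMeasurable fun s => drift L k lam (x s).toL1 := by
  refine stronglyMeasurable_of_tendsto atTop
    (f := fun (J : ℕ) s => ∑ j ∈ Finset.range J,
      lp.single 1 j (driftCoord L k lam (x s) j) (E := fun _ => ℝ)) (fun J => ?_) ?_
  · refine Finset.stronglyMeasurable_fun_sum _ fun j _ => ?_
    exact (lp.singleContinuousLinearMap ℝ (fun _ : ℕ => ℝ) 1 j).continuous.comp_stronglyMeasurable
      (measurable_driftCoord L k lam hx j).stronglyMeasurable
  · rw [tendsto_pi_nhds]
    intro s
    exact (lp.hasSum_single (by norm_num) (drift L k lam (x s).toL1)).tendsto_sum_nat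

theorem intervalIntegrable_drift (L k : ℕ) {lam : ℝ} (hlam : 0 ≤ lam) {x : ℝ → Simplex}
    (hx : Measurable fun s => (x s : ℕ → ℝ)) (a b : ℝ) :
    IntervalIntegrable (fun s => drift L k lam (x s).toL1) volume a b :=
  (intervalIntegrable_const (c := driftBound L k lam)).mono_fun
    (stronglyMeasurable_drift L k lam hx).aestronglyMeasurable
    (ae_of_all _ fun s => (norm_drift_le L k hlam (x s)).trans (le_abs_self _))

theorem integral_drift_apply (L k : ℕ) {lam : ℝ} {x : ℝ → Simplex} {a b : ℝ}
    (hx : IntervalIntegrable (fun s => drift L k lam (x s).toL1) volume a b) (j : ℕ) :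
    (∫ s in a..b, drift L k lam (x s).toL1 : L1) j = ∫ s in a..b, driftCoord L k lam (x s) j :=
  ((lp.evalCLM ℝ (fun _ : ℕ => ℝ) (p := 1) j).intervalIntegral_comp_comm hx).symm

theorem measurable_IccExtend {T : ℝ} (hT : 0 ≤ T) (π : C(Set.Icc (0 : ℝ) T, Simplex)) :
    Measurable fun s => ((Set.IccExtend hT π s : Simplex) : ℕ → ℝ) := by
  refine measurable_pi_lambda _ fun j => Continuous.measurable ?_
  have h1 : Continuous fun s : Simplex => s j :=
    continuous_iff_continuousAt.2 fun s => tendsto_apply_of_tendsto tendsto_id j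
  exact h1.comp π.continuous.Icc_extend'

/-- Error zero means equality in each coordinate, and coordinate evaluations are continuous
functionals that commute with the Bochner integral. Integrability is automatic because the drift is
bounded on the simplex. -/
theorem isSolution_iff {L k : ℕ} {lam : ℝ} (hlam : 0 ≤ lam) {T : ℝ} (hT : 0 ≤ T) (π₀ : Simplex)
    (π : C(Set.Icc (0 : ℝ) T, Simplex)) :
    IsSolution L k lam hT π₀ π ↔ IsApproxSolution L k lam T π₀ (Set.IccExtend hT π) 0 := by
  have hm := measurable_IccExtend hT π
  have hi := intervalIntegrable_drift L k hlam hm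
  have hpt : ∀ t (ht : t ∈ Set.Icc 0 T), Set.IccExtend hT π t = π ⟨t, ht⟩ := fun t ht =>
    Set.IccExtend_of_mem hT π ht
  constructor
  · intro h
    refine ⟨hm, fun t ht J => le_of_eq (Finset.sum_eq_zero fun j _ => ?_)⟩
    have h1 := congrArg (fun r : L1 => r j) (h ⟨t, ht⟩).2
    have h2 : π ⟨t, ht⟩ j = π₀ j + (∫ s in (0 : ℝ)..t,
        drift L k lam (Set.IccExtend hT π s).toL1 : L1) j := h1
    rw [integral_drift_apply L k (hi _ _)] at h2
    rw [hpt t ht, h2]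
    simp
  · intro h t
    refine ⟨hi _ _, ?_⟩
    refine lp.ext (funext fun j => ?_)
    change π t j = π₀ j + (∫ s in (0 : ℝ)..t, drift L k lam (Set.IccExtend hT π s).toL1 : L1) j
    rw [integral_drift_apply L k (hi _ _), ← h.apply_eq t.2, hpt t t.2]

theorem exists_isSolution_of_approx {L k : ℕ} (hkL : k ≤ L) {lam T : ℝ} (hlam : 0 ≤ lam)
    (hT : 0 ≤ T) {π₀ : Simplex} {x₀ : ℕ → Simplex} {x : ℕ → ℝ → Simplex} {ε : ℕ → ℝ}
    (hx : ∀ n, IsApproxSolution L k lam T (x₀ n) (x n) (ε n)) (hε : Tendsto ε atTop (𝓝 0))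
    (hx₀ : Tendsto x₀ atTop (𝓝 π₀)) :
    ∃ π : C(Set.Icc (0 : ℝ) T, Simplex), IsSolution L k lam hT π₀ π := by
  obtain ⟨y, hy, hyp⟩ := exists_solution_of_approx hkL hlam hT hx hε hx₀
  have hcont : Continuous fun t : Set.Icc (0 : ℝ) T => y t :=
    (LipschitzWith.of_dist_le_mul (f := fun t : Set.Icc (0 : ℝ) T => y t) (K := ⟨2 * driftBound L k lam,
      mul_nonneg zero_le_two (driftBound_nonneg L k hlam)⟩)
      fun s t => hy.dist_apply_le hlam s.2 t.2).continuous
  refine ⟨⟨fun t => y t, hcont⟩, (isSolution_iff hlam hT π₀ _).2 ?_⟩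
  have : Set.IccExtend hT (⟨fun t => y t, hcont⟩ : C(Set.Icc (0 : ℝ) T, Simplex)) = y :=
    funext hyp
  rwa [this]

theorem isSolution_unique {L k : ℕ} (hkL : k ≤ L) {lam T : ℝ} (hlam : 0 ≤ lam)
    (hT : 0 ≤ T) {π₀ : Simplex} {π π' : C(Set.Icc (0 : ℝ) T, Simplex)}
    (h : IsSolution L k lam hT π₀ π) (h' : IsSolution L k lam hT π₀ π') : π' = π := by
  rw [isSolution_iff hlam] at h h'
  refine ContinuousMap.ext fun t => dist_le_zero.1 ?_
  have := h'.dist_le hkL hlam h t.2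
  simpa using this

/-! ### Bounds for the generator -/

/-- The sum of `u B` over arrivals to `B` and of `v j` over departures from `j`, weighted by the
rates of these transitions. -/
def rateSum {n L c : ℕ} (k : ℕ) (lam : ℝ) (S : Storage n L c) (R : Routing n L k) (q : Fin n → ℕ)
    (u : Finset (Fin n) → ℝ) (v : Fin n → ℝ) : ℝ :=
  n * lam * (1 / (S.numFiles : ℝ) * ∑ i, ∑ B, R.prob q (S.servers i) B * u B) +
    ∑ j, if 0 < q j then (k : ℝ) * v j else 0

/-- Arrivals have total rate `n λ` and departures at most `n k`. The bound on `u` is needed only for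
sets of `k` servers, as the routing charges no others. -/
theorem abs_rateSum_le {n L c k : ℕ} (hc : 1 ≤ c) (hn : L ≤ n) {lam : ℝ} (hlam : 0 ≤ lam)
    (S : Storage n L c) (R : Routing n L k) (q : Fin n → ℕ) {u : Finset (Fin n) → ℝ}
    {v : Fin n → ℝ} {a b : ℝ} (hb : 0 ≤ b) (hu : ∀ B, B.card = k → |u B| ≤ a)
    (hv : ∀ j, |v j| ≤ b) : |rateSum k lam S R q u v| ≤ n * lam * a + n * (k * b) := by
  have hN := S.numFiles_pos hc hn
  unfold rateSum
  refine (abs_add_le _ _).trans (add_le_add ?_ ?_)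
  · rw [abs_mul, abs_of_nonneg (by positivity)]
    gcongr
    rw [abs_mul, abs_of_nonneg (by positivity), one_div, inv_mul_le_iff₀ hN]
    calc |∑ i, ∑ B, R.prob q (S.servers i) B * u B| ≤ ∑ _i : Fin S.numFiles, a := by
          refine (Finset.abs_sum_le_sum_abs _ _).trans (Finset.sum_le_sum fun i _ => ?_)
          calc |∑ B, R.prob q (S.servers i) B * u B|
              ≤ ∑ B, R.prob q (S.servers i) B * a := by
                refine (Finset.abs_sum_le_sum_abs _ _).trans (Finset.sum_le_sum fun B _ => ?_)
                rw [abs_mul, abs_of_nonneg (R.nonneg _ _ _)]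
                by_cases hB : R.prob q (S.servers i) B = 0
                · simp [hB]
                · exact mul_le_mul_of_nonneg_left
                    (hu B (R.shortest _ _ _ (S.card_servers i) hB).2.1) (R.nonneg _ _ _)
            _ = a := by rw [← Finset.sum_mul, R.sum_eq_one _ _ (S.card_servers i), one_mul]
      _ = S.numFiles * a := by simp
  · calc _ ≤ ∑ _j : Fin n, (k : ℝ) * b := by
          refine (Finset.abs_sum_le_sum_abs _ _).trans (Finset.sum_le_sum fun j _ => ?_)
          split_ifs
          · rw [abs_mul, Nat.abs_cast]
            gcongr
            exact hv j
          · simpa using by positivity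
      _ = _ := by simp

theorem abs_generator_le {n L c k : ℕ} (hc : 1 ≤ c) (hn : L ≤ n) {lam : ℝ} (hlam : 0 ≤ lam)
    (S : Storage n L c) (R : Routing n L k) {f : (Fin n → ℕ) → ℝ} {C : ℝ} (hf : ∀ q, |f q| ≤ C)
    (q : Fin n → ℕ) : |generator k lam S R f q| ≤ n * lam * (2 * C) + n * (k * (2 * C)) := by
  have hC : 0 ≤ C := (abs_nonneg _).trans (hf q)
  have h : ∀ q', |f q' - f q| ≤ 2 * C := fun q' => by
    rw [two_mul]
    exact (abs_sub _ _).trans (add_le_add (hf _) (hf _))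
  exact abs_rateSum_le hc hn hlam S R q (by positivity) (fun B _ => h _) fun j => h _

/-- The carré du champ identity: `b² - a² - 2 a (b - a) = (b - a)²` for each transition. -/
theorem generator_sq_sub {n L c k : ℕ} {lam : ℝ} (S : Storage n L c) (R : Routing n L k)
    (f : (Fin n → ℕ) → ℝ) (q : Fin n → ℕ) :
    generator k lam S R (fun q => f q ^ 2) q - 2 * f q * generator k lam S R f q =
      rateSum k lam S R q (fun B => (f (arrive q B) - f q) ^ 2)
        (fun j => (f (depart q j) - f q) ^ 2) := by
  rw [sub_eq_iff_eq_add]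
  unfold generator rateSum
  have h1 : ∀ i, ∑ B, R.prob q (S.servers i) B * (f (arrive q B) ^ 2 - f q ^ 2) =
      ∑ B, R.prob q (S.servers i) B * (f (arrive q B) - f q) ^ 2 +
        2 * f q * ∑ B, R.prob q (S.servers i) B * (f (arrive q B) - f q) := fun i => by
    rw [Finset.mul_sum, ← Finset.sum_add_distrib]
    exact Finset.sum_congr rfl fun B _ => by ring
  have h2 : (∑ j, if 0 < q j then (k : ℝ) * (f (depart q j) ^ 2 - f q ^ 2) else 0) =
      (∑ j, if 0 < q j then (k : ℝ) * (f (depart q j) - f q) ^ 2 else 0) +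
        2 * f q * ∑ j, if 0 < q j then (k : ℝ) * (f (depart q j) - f q) else 0 := by
    rw [Finset.mul_sum, ← Finset.sum_add_distrib]
    exact Finset.sum_congr rfl fun j _ => by split_ifs <;> ring
  simp_rw [h1]
  rw [h2, Finset.sum_add_distrib, ← Finset.mul_sum]
  ring

/-- Arrivals move a coordinate by at most `k / n` at rate `n λ`, departures by at most `1 / n` at
rate at most `n k`. -/
theorem generator_sq_sub_empirical_le {n L c k : ℕ} (hc : 1 ≤ c) (hn : L ≤ n) (hn0 : 0 < n)
    {lam : ℝ} (hlam : 0 ≤ lam) (S : Storage n L c) (R : Routing n L k) (j : ℕ) (q : Fin n → ℕ) :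
    generator k lam S R (fun q => empirical q j ^ 2) q -
      2 * empirical q j * generator k lam S R (fun q => empirical q j) q ≤
        (lam * k ^ 2 + k) / n := by
  have hn' : (0 : ℝ) < n := by exact_mod_cast hn0
  rw [generator_sq_sub S R (fun q => empirical q j)]
  have hu : ∀ B : Finset (Fin n), B.card = k →
      |(empirical (arrive q B) j - empirical q j) ^ 2| ≤ (k / n : ℝ) ^ 2 := by
    intro B hB
    rw [abs_pow]
    gcongr
    rw [empirical_arrive_sub hn0, abs_mul, abs_of_nonneg (by positivity), one_div,
      inv_mul_le_iff₀ hn', mul_div_cancel₀ _ hn'.ne']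
    have h1 : ((B.filter fun i => q i + 1 = j).card : ℝ) ≤ k := by
      exact_mod_cast hB ▸ Finset.card_filter_le B _
    have h2 : ((B.filter fun i => q i = j).card : ℝ) ≤ k := by
      exact_mod_cast hB ▸ Finset.card_filter_le B _
    rw [abs_le]
    constructor <;> linarith [(Nat.cast_nonneg (B.filter fun i => q i + 1 = j).card : (0 : ℝ) ≤ _),
      (Nat.cast_nonneg (B.filter fun i => q i = j).card : (0 : ℝ) ≤ _)]
  have hv : ∀ i, |(empirical (depart q i) j - empirical q j) ^ 2| ≤ (1 / n : ℝ) ^ 2 := by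
    intro i
    rw [abs_pow]
    gcongr
    rw [empirical_depart_sub hn0, abs_mul, abs_of_nonneg (by positivity)]
    refine mul_le_of_le_one_right (by positivity) ?_
    split_ifs <;> simp
  refine (le_abs_self _).trans
    ((abs_rateSum_le hc hn hlam S R q (by positivity) hu hv).trans (le_of_eq ?_))
  field_simp

/-! ### The martingale part of the empirical measure -/

theorem integral_abs_le_of_sq {Ω : Type*} {mΩ : MeasurableSpace Ω} {P : Measure Ω}
    [IsProbabilityMeasure P] {X : Ω → ℝ} (hX : Integrable X P)
    (hX2 : Integrable (fun ω => X ω ^ 2) P) {a γ : ℝ} (ha : 0 < a)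
    (h : ∫ ω, X ω ^ 2 ∂P ≤ γ) : ∫ ω, |X ω| ∂P ≤ a + γ / a := by
  calc ∫ ω, |X ω| ∂P ≤ ∫ ω, (a + X ω ^ 2 / a) ∂P := by
        refine integral_mono hX.abs ((integrable_const a).add (hX2.div_const a)) fun ω => ?_
        have h2 : |X ω| * a ≤ a * a + X ω ^ 2 := by
          rw [← sq_abs]
          nlinarith [sq_nonneg (|X ω| - a), abs_nonneg (X ω)]
        have h3 : |X ω| - a ≤ X ω ^ 2 / a := by
          rw [le_div_iff₀ ha, sub_mul]
          linarith
        exact sub_le_iff_le_add'.1 h3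
    _ = a + (∫ ω, X ω ^ 2 ∂P) / a := by
        rw [integral_add (integrable_const a) (hX2.div_const a), integral_div]
        simp
    _ ≤ a + γ / a := by gcongr

theorem IsQueueProcess.measurable_path {n L c k : ℕ} {lam : ℝ} {T : ℝ} {hT : 0 ≤ T}
    {S : Storage n L c} {R : Routing n L k} {Ω : Type*} {mΩ : MeasurableSpace Ω} {P : Measure Ω}
    {ℱ : Filtration (Set.Icc (0 : ℝ) T) mΩ} {q : Fin n → ℕ} {Q : Ω → Cadlag T (Fin n → ℕ)}
    (hQ : IsQueueProcess k lam hT S R P ℱ q Q) (ω : Ω) :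
    Measurable fun s => Q ω (Set.projIcc 0 T hT s) :=
  (measurable_uncurry_of_rightCts hT (X := fun t ω => Q ω t)
    (fun t => (hQ.adapted t).mono (ℱ.le t) le_rfl) fun ω => (Q ω).rightCts).comp
    measurable_prodMk_right

theorem IsQueueProcess.measure_martingale_le {n L c k : ℕ} (hc : 1 ≤ c) (hn : L ≤ n) (hn0 : 0 < n)
    {lam : ℝ} (hlam : 0 ≤ lam) {T : ℝ} {hT : 0 ≤ T} {S : Storage n L c} {R : Routing n L k}
    {Ω : Type*} {mΩ : MeasurableSpace Ω} {P : Measure Ω} [IsProbabilityMeasure P]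
    {ℱ : Filtration (Set.Icc (0 : ℝ) T) mΩ} {q : Fin n → ℕ} {Q : Ω → Cadlag T (Fin n → ℕ)}
    (hQ : IsQueueProcess k lam hT S R P ℱ q Q) (j : ℕ) {δ : ℝ} (hδ : 0 < δ) :
    P {ω | ∃ t : Set.Icc (0 : ℝ) T, δ < |empirical (Q ω t) j - (∫ s in (0 : ℝ)..t,
      Set.IccExtend hT (fun s => generator k lam S R (fun q => empirical q j) (Q ω s)) s) -
        empirical q j|} ≤ ENNReal.ofReal ((1 + (lam * k ^ 2 + k) * T) / √n / δ) := by
  have hn' : (0 : ℝ) < n := by exact_mod_cast hn0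
  set f : (Fin n → ℕ) → ℝ := fun q => empirical q j with hf
  have hf1 : ∀ q, |f q| ≤ 1 := fun q => by
    rw [abs_of_nonneg ((empirical q).nonneg j)]
    exact ((empirical q).mem_unit j).2
  have hf2 : ∀ q, |f q ^ 2| ≤ 1 := fun q => by
    rw [abs_pow]
    exact pow_le_one₀ (abs_nonneg _) (hf1 q)
  -- A crude bound that grows with `n`; it serves integrability only and does not enter the
  -- estimate.
  set C : ℝ := 1 + (n * lam * (2 * 1) + n * (k * (2 * 1))) with hC
  have hC1 : 1 ≤ C := by
    have : 0 ≤ n * lam * (2 * 1) + n * (k * (2 * 1) : ℝ) := by positivity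
    linarith
  have hgC : ∀ q, |generator k lam S R f q| ≤ C := fun q =>
    (abs_generator_le hc hn hlam S R hf1 q).trans (by linarith)
  have hhC : ∀ q, |generator k lam S R (fun q => f q ^ 2) q| ≤ C := fun q =>
    (abs_generator_le hc hn hlam S R hf2 q).trans (by linarith)
  have meas : ∀ (g : (Fin n → ℕ) → ℝ) t, Measurable[ℱ t] fun ω => g (Q ω t) := fun g t =>
    (Measurable.of_discrete (f := g)).comp (hQ.adapted t)
  have rc : ∀ (g : (Fin n → ℕ) → ℝ) ω t,
      ContinuousWithinAt (fun t => g (Q ω t)) (Set.Ici t) t := fun g ω t =>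
    (continuous_of_discreteTopology (f := g)).continuousAt.comp_continuousWithinAt
      ((Q ω).rightCts t)
  have hX := hQ.martingale f ⟨1, hf1⟩
  have hY := hQ.martingale (fun q => f q ^ 2) ⟨1, hf2⟩
  have hsq := integral_sq_martingale_increment_le hT (P := P) (ℱ := ℱ) (C := C)
    (γ := (lam * k ^ 2 + k) / n) (f := fun t ω => f (Q ω t))
    (g := fun t ω => generator k lam S R f (Q ω t))
    (h := fun t ω => generator k lam S R (fun q => f q ^ 2) (Q ω t))
    (meas _) (meas _) (meas _) (rc _) (rc _) (rc _) (fun t ω => (hf1 _).trans hC1)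
    (fun t ω => hgC _) (fun t ω => hhC _) hX hY
    (fun t ω => generator_sq_sub_empirical_le hc hn hn0 hlam S R j (Q ω t))
  set N : Set.Icc (0 : ℝ) T → Ω → ℝ := fun t ω => f (Q ω t) -
    (∫ s in (0 : ℝ)..t, Set.IccExtend hT (fun s => generator k lam S R f (Q ω s)) s) - f q with hNdef
  have hN : Martingale N ℱ P := hX.sub (martingale_const ℱ P (f q))
  have sg : ∀ ω, Measurable fun s => generator k lam S R f (Q ω (Set.projIcc 0 T hT s)) := fun ω =>
    (Measurable.of_discrete (f := generator k lam S R f)).comp (hQ.measurable_path ω)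
  have hNr : ∀ ω t, ContinuousWithinAt (fun t => N t ω) (Set.Ici t) t := fun ω t => by
    have h0 := rightCts_sub_primitive hT (f := fun t => f (Q ω t))
      (g := fun s => generator k lam S R f (Q ω s)) (rc f ω) (sg ω) (fun s => hgC _) t
    exact h0.sub continuousWithinAt_const
  refine (measure_exists_lt_abs_le hT hN hNr hδ).trans (ENNReal.ofReal_le_ofReal ?_)
  gcongr
  set Y : Ω → ℝ := N ⟨T, Set.right_mem_Icc.2 hT⟩ with hYdef
  have hYi : Integrable Y P := hN.integrable ⟨T, Set.right_mem_Icc.2 hT⟩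
  have hYb : ∀ ω, |Y ω| ≤ 1 + C * T + 1 := fun ω =>
    (abs_sub _ _).trans (add_le_add ((abs_sub _ _).trans (add_le_add (hf1 _)
      (abs_integral_le_mul (fun s => hgC _) hT))) (hf1 _))
  have hY2i : Integrable (fun ω => Y ω ^ 2) P := by
    refine Integrable.of_bound (hYi.1.pow 2) ((1 + C * T + 1) ^ 2) (ae_of_all _ fun ω => ?_)
    rw [norm_pow]
    exact pow_le_pow_left₀ (norm_nonneg _) (hYb ω) 2
  have hsq' : ∫ ω, Y ω ^ 2 ∂P ≤ (lam * k ^ 2 + k) / n * T := by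
    refine le_trans (le_of_eq (integral_congr_ae ?_)) hsq
    filter_upwards [hQ.initial] with ω hω
    simp only [hYdef, hNdef, hω]
  have hs : 0 < √(n : ℝ) := Real.sqrt_pos.2 hn'
  -- The choice `a = 1/√n` balances `a` against the second moment of order `1/n` divided by `a`.
  refine (integral_abs_le_of_sq hYi hY2i (a := 1 / √(n : ℝ)) (by positivity) hsq').trans
    (le_of_eq ?_)
  have hss : (n : ℝ) = √n * √n := (Real.mul_self_sqrt hn'.le).symm
  rw [hss]
  simp only [Real.sqrt_mul_self hs.le]
  field_simp

/-! ### The empirical measure is an approximate solution -/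

theorem tsum_ofReal_geometric (a : ℝ) (ha : 0 ≤ a) :
    ∑' j : ℕ, ENNReal.ofReal (a * (2 / 3) ^ j) = ENNReal.ofReal (3 * a) := by
  rw [← ENNReal.ofReal_tsum_of_nonneg (fun j => by positivity)
    ((summable_geometric_of_lt_one (by norm_num) (by norm_num)).mul_left a), tsum_mul_left,
    tsum_geometric_of_lt_one (by norm_num) (by norm_num)]
  congr 1
  norm_num
  ring

/-- The thresholds `δ (3/2)ʲ` grow slowly enough to be summable against `2⁻ʲ`, with `∑ (3/4)ʲ = 4`,
and fast enough that the failure probabilities, of order `(2/3)ʲ`, are summable as well. -/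
theorem sum_threshold_div_two_pow_le {e : ℕ → ℝ} {δ a : ℝ} (hδ : 0 ≤ δ) (ha : 0 ≤ a)
    (he : ∀ j, e j ≤ δ * (3 / 2) ^ j + a) (J : ℕ) :
    ∑ j ∈ Finset.range J, e j / 2 ^ j ≤ 4 * δ + 2 * a := by
  have h1 := sum_div_two_pow_le ha (fun _ => le_refl a) J
  have h2 : ∑ j ∈ Finset.range J, δ * (3 / 4 : ℝ) ^ j ≤ 4 * δ := by
    rw [← Finset.mul_sum]
    have hs := summable_geometric_of_lt_one (r := (3 / 4 : ℝ)) (by norm_num) (by norm_num)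
    have := hs.sum_le_tsum (Finset.range J) fun j _ => by positivity
    rw [tsum_geometric_of_lt_one (by norm_num) (by norm_num)] at this
    norm_num at this
    nlinarith
  refine le_trans ?_ (add_le_add h2 h1)
  rw [← Finset.sum_add_distrib]
  refine Finset.sum_le_sum fun j _ => ?_
  have h3 : (3 / 4 : ℝ) ^ j = (3 / 2) ^ j / 2 ^ j := by rw [← div_pow]; norm_num
  rw [h3, ← mul_div_assoc, ← add_div]
  gcongr
  exact he j

/-- If no coordinate exceeds its threshold, the defect is at most the martingale part plus the time
integral of the sampling error. The exceptional set need not be shown measurable, since only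
monotonicity and subadditivity of the measure are used. -/
theorem IsQueueProcess.measure_not_isApproxSolution_le {n L c k : ℕ} (hkL : k ≤ L) (hc : 1 ≤ c)
    (hn : L ≤ n) (hn0 : 0 < n) {lam : ℝ} (hlam : 0 ≤ lam) {T : ℝ} {hT : 0 ≤ T} {S : Storage n L c}
    {R : Routing n L k} {Ω : Type*} {mΩ : MeasurableSpace Ω} {P : Measure Ω}
    [IsProbabilityMeasure P] {ℱ : Filtration (Set.Icc (0 : ℝ) T) mΩ} {q : Fin n → ℕ}
    {Q : Ω → Cadlag T (Fin n → ℕ)} (hQ : IsQueueProcess k lam hT S R P ℱ q Q) {δ : ℝ}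
    (hδ : 0 < δ) :
    P {ω | ¬ IsApproxSolution L k lam T (empirical q)
      (fun s => empirical (Q ω (Set.projIcc 0 T hT s)))
      (4 * δ + 2 * (2 * lam * samplingConst L k / n * T))} ≤
      ENNReal.ofReal (3 * ((1 + (lam * k ^ 2 + k) * T) / √n / δ)) := by
  have hD0 : 0 ≤ 2 * lam * samplingConst L k / n :=
    (abs_nonneg _).trans (abs_generator_empirical_sub_le hkL hc hn hn0 hlam S R 0 q)
  set bad : ℕ → Set Ω := fun j => {ω | ∃ t : Set.Icc (0 : ℝ) T,
    δ * (3 / 2) ^ j < |empirical (Q ω t) j - (∫ s in (0 : ℝ)..t,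
      Set.IccExtend hT (fun s => generator k lam S R (fun q => empirical q j) (Q ω s)) s) -
        empirical q j|} with hbad
  have hsub : {ω | ¬ IsApproxSolution L k lam T (empirical q)
      (fun s => empirical (Q ω (Set.projIcc 0 T hT s)))
      (4 * δ + 2 * (2 * lam * samplingConst L k / n * T))} ⊆ ⋃ j, bad j := by
    intro ω hω
    by_contra hgood
    simp only [hbad, Set.mem_iUnion, Set.mem_ofPred_eq, not_exists, not_lt] at hgood
    have hmQ := hQ.measurable_path ω
    have hmE : Measurable fun s => (empirical (Q ω (Set.projIcc 0 T hT s)) : ℕ → ℝ) :=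
      (Measurable.of_discrete (f := fun q : Fin n → ℕ => (empirical q : ℕ → ℝ))).comp hmQ
    refine hω ⟨hmE, fun t ht J => ?_⟩
    refine sum_threshold_div_two_pow_le hδ.le (mul_nonneg hD0 hT) (fun j => ?_) J
    have h1 := hgood j ⟨t, ht⟩
    have hdm := measurable_driftCoord L k lam hmE j
    have hgm : Measurable fun s =>
        generator k lam S R (fun q => empirical q j) (Q ω (Set.projIcc 0 T hT s)) :=
      (Measurable.of_discrete (f := generator k lam S R fun q => empirical q j)).comp hmQ
    have hdi := intervalIntegrable_of_abs_le hdm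
      (fun s => (empirical (Q ω (Set.projIcc 0 T hT s))).abs_driftCoord_le L k hlam j) 0 t
    have hgi := intervalIntegrable_of_abs_le hgm
      (fun s => abs_generator_le hc hn hlam S R (f := fun q => empirical q j) (C := 1) (fun q => by
        rw [abs_of_nonneg ((empirical q).nonneg j)]
        exact ((empirical q).mem_unit j).2) _) 0 t
    have h2 : |(∫ s in (0 : ℝ)..t,
          generator k lam S R (fun q => empirical q j) (Q ω (Set.projIcc 0 T hT s))) -
        ∫ s in (0 : ℝ)..t, driftCoord L k lam (empirical (Q ω (Set.projIcc 0 T hT s))) j| ≤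
        2 * lam * samplingConst L k / n * T := by
      rw [← intervalIntegral.integral_sub hgi hdi]
      refine (abs_integral_le_mul (fun s => abs_generator_empirical_sub_le hkL hc hn hn0 hlam S R j
        (Q ω (Set.projIcc 0 T hT s))) ht.1).trans ?_
      exact mul_le_mul_of_nonneg_left ht.2 hD0
    have h3 : |empirical (Q ω ⟨t, ht⟩) j - (∫ s in (0 : ℝ)..t,
          generator k lam S R (fun q => empirical q j) (Q ω (Set.projIcc 0 T hT s))) -
        empirical q j| ≤ δ * (3 / 2) ^ j := h1
    rw [Set.projIcc_of_mem hT ht]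
    refine le_trans ?_ (add_le_add h3 h2)
    refine le_trans (le_of_eq ?_) (abs_add_le _ _)
    congr 1
    ring
  have hterm : ∀ j, P (bad j) ≤
      ENNReal.ofReal ((1 + (lam * k ^ 2 + k) * T) / √n / δ * (2 / 3) ^ j) := by
    intro j
    refine (hQ.measure_martingale_le hc hn hn0 hlam j
      (by positivity : 0 < δ * (3 / 2) ^ j)).trans (le_of_eq ?_)
    congr 1
    rw [← div_div, div_eq_mul_inv _ ((3 / 2 : ℝ) ^ j), ← inv_pow]
    norm_num
  calc _ ≤ P (⋃ j, bad j) := measure_mono hsub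
    _ ≤ ∑' j, P (bad j) := measure_iUnion_le _
    _ ≤ ∑' j : ℕ, ENNReal.ofReal ((1 + (lam * k ^ 2 + k) * T) / √n / δ * (2 / 3) ^ j) :=
        ENNReal.tsum_le_tsum hterm
    _ = _ := tsum_ofReal_geometric _ (by positivity)

theorem IsApproxSolution.mono {L k : ℕ} {lam T : ℝ} {x₀ : Simplex} {x : ℝ → Simplex} {ε ε' : ℝ}
    (h : IsApproxSolution L k lam T x₀ x ε) (hε : ε ≤ ε') : IsApproxSolution L k lam T x₀ x ε' :=
  ⟨h.measurable, fun t ht J => (h.defect t ht J).trans hε⟩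

/-- The identity time change is enough. -/
theorem skorohodEDist_ofContinuous_le {T : ℝ} {E : Type*} [MetricSpace E] (x : Cadlag T E)
    (y : C(Set.Icc (0 : ℝ) T, E)) {a : ℝ} (h : ∀ t, dist (x t) (y t) ≤ a) :
    skorohodEDist x (Cadlag.ofContinuous y) ≤ ENNReal.ofReal a := by
  refine (iInf_le _ (OrderIso.refl _)).trans (max_le ?_ (iSup_le fun t => ?_))
  · simp
  · rw [edist_dist]
    exact ENNReal.ofReal_le_ofReal (h t)

/-! ### The law of large numbers -/

theorem tendsto_measure_not_isApproxSolution {L k c : ℕ} (hk : 1 ≤ k) (hkL : k ≤ L) (hc : 1 ≤ c)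
    {lam : ℝ} (hlam : 0 ≤ lam) {T : ℝ} (hT : 0 ≤ T) {S : ∀ n, Storage n L c}
    {R : ∀ n, Routing n L k} {Ω : ℕ → Type*} {mΩ : ∀ n, MeasurableSpace (Ω n)}
    {P : ∀ n, Measure (Ω n)} [∀ n, IsProbabilityMeasure (P n)]
    {ℱ : ∀ n, Filtration (Set.Icc (0 : ℝ) T) (mΩ n)} {q : ∀ n, Fin n → ℕ}
    {Q : ∀ n, Ω n → Cadlag T (Fin n → ℕ)}
    (hQ : ∀ n, L ≤ n → IsQueueProcess k lam hT (S n) (R n) (P n) (ℱ n) (q n) (Q n))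
    {η : ℝ} (hη : 0 < η) :
    Tendsto (fun n => P n {ω | ¬ IsApproxSolution L k lam T (empirical (q n))
      (fun s => empirical (Q n ω (Set.projIcc 0 T hT s))) η}) atTop (𝓝 0) := by
  have hlim : Tendsto (fun n : ℕ => ENNReal.ofReal
      (3 * ((1 + (lam * k ^ 2 + k) * T) / √n / (η / 8)))) atTop (𝓝 0) := by
    rw [← ENNReal.ofReal_zero]
    refine ENNReal.tendsto_ofReal ?_
    have h1 : Tendsto (fun n : ℕ => √(n : ℝ)) atTop atTop :=
      Real.tendsto_sqrt_atTop.comp tendsto_natCast_atTop_atTop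
    simpa using ((h1.const_div_atTop (1 + (lam * k ^ 2 + k) * T)).div_const (η / 8)).const_mul 3
  have herr : Tendsto (fun n : ℕ => 2 * (2 * lam * samplingConst L k / n * T)) atTop (𝓝 0) := by
    simpa using ((tendsto_natCast_atTop_atTop.const_div_atTop
      (2 * lam * samplingConst L k)).mul_const T).const_mul 2
  refine tendsto_of_tendsto_of_tendsto_of_le_of_le' tendsto_const_nhds hlim
    (Eventually.of_forall fun n => zero_le) ?_
  -- With `δ = η / 8` the martingale part uses up `4 δ = η / 2`; the sampling error has the other
  -- half.
  filter_upwards [eventually_ge_atTop L, herr.eventually_le_const (half_pos hη)] with n hn hn2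
  refine (measure_mono ?_).trans ((hQ n hn).measure_not_isApproxSolution_le hkL hc hn (by omega)
    hlam (by positivity : 0 < η / 8))
  simp only [Set.ofPred_subset_ofPred]
  exact fun ω hω hω' => hω (hω'.mono (by linarith))

end BatchMDS

end

open BatchMDS

theorem theorem2p2 (L k c : ℕ) (hk : 1 ≤ k) (hkL : k ≤ L) (hc : 1 ≤ c)
    (lam : ℝ) (hlam : 0 < lam) (T : ℝ) (hT : 0 ≤ T)
    (S : ∀ n, Storage n L c) (R : ∀ n, Routing n L k)
    (Ω : ℕ → Type*) [mΩ : ∀ n, MeasurableSpace (Ω n)]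
    (P : ∀ n, Measure (Ω n)) [∀ n, IsProbabilityMeasure (P n)]
    (ℱ : ∀ n, Filtration (Set.Icc (0 : ℝ) T) (mΩ n))
    (q : ∀ n, Fin n → ℕ) (Q : ∀ n, Ω n → Cadlag T (Fin n → ℕ))
    (hQ : ∀ n, L ≤ n → IsQueueProcess k lam hT (S n) (R n) (P n) (ℱ n) (q n) (Q n))
    (π₀ : Simplex) (hπ₀ : Tendsto (fun n => empirical (q n)) atTop (𝓝 π₀)) :
    ∃ π : C(Set.Icc (0 : ℝ) T, Simplex),
      IsSolution L k lam hT π₀ π ∧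
      (∀ π' : C(Set.Icc (0 : ℝ) T, Simplex), IsSolution L k lam hT π₀ π' → π' = π) ∧
      ∀ ε : ℝ≥0∞, 0 < ε →
        Tendsto (fun n => P n {ω | ε ≤ skorohodEDist (empiricalPath (Q n ω))
          (Cadlag.ofContinuous π)}) atTop (𝓝 0) := by
  have hbad := fun η hη => tendsto_measure_not_isApproxSolution hk hkL hc hlam.le hT hQ (η := η) hη
  -- sample paths of the queues are approximate solutions, hence a solution exists
  have hpath : ∀ m : ℕ, ∃ n, m ≤ n ∧ ∃ ω, IsApproxSolution L k lam T (empirical (q n))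
      (fun s => empirical (Q n ω (Set.projIcc 0 T hT s))) (1 / ((m : ℝ) + 1)) := by
    intro m
    -- The exceptional set has probability below one, so it misses some `ω`. Requiring `m ≤ n` lets
    -- the initial values converge along the chosen systems.
    obtain ⟨n, hn, hlt⟩ := ((eventually_ge_atTop m).and
      ((hbad (1 / ((m : ℝ) + 1)) (by positivity)).eventually_lt_const zero_lt_one)).exists
    refine ⟨n, hn, ?_⟩
    by_contra hno
    rw [not_exists] at hno
    simp only [hno, not_false_eq_true, Set.ofPred_true, measure_univ, lt_irrefl] at hlt
  choose n hn ω hω using hpath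
  obtain ⟨π, hπ⟩ := exists_isSolution_of_approx hkL hlam.le hT hω
    tendsto_one_div_add_atTop_nhds_zero_nat (hπ₀.comp (tendsto_atTop_mono hn tendsto_id))
  refine ⟨π, hπ, fun π' hπ' => isSolution_unique hkL hlam.le hT hπ hπ', fun ε hε => ?_⟩
  -- `ε` may be infinite, so a finite positive `e < ε` is used.
  obtain ⟨e, he0, he⟩ := ENNReal.lt_iff_exists_nnreal_btwn.1 hε
  have he0' : (0 : ℝ) < e := by exact_mod_cast he0
  have hG := growthConst_pos L k lam T
  -- Both the defect and the initial distance are kept below `η`, so the stability estimate gives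
  -- the distance `2 η` times the growth constant, which is `e`.
  set η : ℝ := e / (2 * growthConst L k lam T) with hη
  have hη0 : 0 < η := by positivity
  refine tendsto_of_tendsto_of_tendsto_of_le_of_le' tendsto_const_nhds (hbad η hη0)
    (Eventually.of_forall fun n => zero_le) ?_
  filter_upwards [(tendsto_iff_dist_tendsto_zero.1 hπ₀).eventually_le_const hη0] with n hn
  -- By contraposition: an approximate solution with error `η` stays within `e < ε` of `π`.
  refine measure_mono fun ω (hω : ε ≤ _) happ => ?_
  have hle : skorohodEDist (empiricalPath (Q n ω)) (Cadlag.ofContinuous π) ≤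
      ENNReal.ofReal (growthConst L k lam T * (η + 0 + η)) := by
    refine skorohodEDist_ofContinuous_le _ _ fun t => ?_
    have h := happ.dist_le hkL hlam.le ((isSolution_iff hlam.le hT π₀ π).1 hπ) t.2
    simp only [Set.IccExtend_val, Set.projIcc_val] at h
    refine h.trans ?_
    gcongr
  have heq : growthConst L k lam T * (η + 0 + η) = e := by
    rw [hη]
    field_simp
    ring
  rw [heq, ENNReal.ofReal_coe_nnreal] at hle
  exact absurd (hω.trans hle) (not_le.2 he)
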